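/- Let $n\ge 2$, $0<L<\lambda$, $0<v^*<v_{\max}$ and $\mu>0$. Let $V:(L,\infty)\to[0,\infty)$ be a $C^3$ function with $\lim_{x\to L^+}V(x)=+\infty$, $V(x)=0$ for $x\ge\lambda$, and $V'(x)<0$, $V''(x)>0$ for $x\in(L,\lambda)$. Let $b:\mathbb{R}\to(v^*-v_{\max},v^*)$ be a $C^2$ increasing function with $b(0)=0$, $b'(0)>0$ and $x\,b(x)>0$ for $x\ne 0$. Write $(s,v)=(s_2,\dots,s_n,v_1,\dots,v_n)\in\mathbb{R}^{2n-1}$ with the Euclidean norm and use the convention $V'(s_1)=V''(s_1)=V'(s_{n+1})=V''(s_{n+1})=0$. Define $$\Omega_S=\{(s,v): s_i>L\ (2\le i\le n),\ 0<v_i<v_{\max}\ (1\le i\le n)\},$$ $$E_S=\{(s,v): s_i\ge\lambda\ (2\le i\le n),\ v_i=v^*\ (1\le i\le n)\},$$ $$f_i(s)=v^*-b\big(V'(s_{i+1})-V'(s_i)\big),\qquad \beta(v,y)=\frac{v_{\max}^3(v+y)-2v_{\max}^2yv}{2(v_{\max}-v)^2v^2},$$ $$Z_i(s,v)=-v_{\max}^2\,b'\big(V'(s_{i+1})-V'(s_i)\big)\big(V''(s_{i+1})(v_i-v_{i+1})-V''(s_i)(v_{i-1}-v_i)\big),$$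 $$F_i=\frac{1}{\beta(v_i,f_i(s))}\left(\frac{Z_i(s,v)-\mu v_{\max}^2(v_i-f_i(s))}{v_i(v_{\max}-v_i)}+V'(s_i)-V'(s_{i+1})\right),$$ $$H_S(s,v)=\frac{v_{\max}^2}{2}\sum_{i=1}^n\frac{(v_i-f_i(s))^2}{v_i(v_{\max}-v_i)}+\sum_{i=2}^nV(s_i).$$ Consider on $\Omega_S$ the closed-loop system $$\dot s_i=v_{i-1}-v_i\quad(i=2,\dots,n),\qquad \dot v_i=F_i\quad(i=1,\dots,n).$$ The set of equilibrium points of this system in $\Omega_S$ is exactly $E_S$, and $E_S$ is unbounded and not compact. From every initial state in $\Omega_S$ there is a solution with values in $\Omega_S$ defined for all $t\ge 0$. Moreover, there exist functions $\bar\sigma\in KL$ and $\bar a\in K_\infty$ such that every maximal solution $(s(t),v(t))\in\Omega_S$ is defined for all $t\ge0$, and every solution satisfies, for all $t\geq 0$ in its domain, $$\bar a\big(\mathrm{dist}((s(t),v(t)),E_S)\big)\le H_S(s(t),v(t))\le\bar\sigma\big(H_S(s(0),v(0)),t\big).$$ Here $K$ is the class of continuous, strictly increasing functions $a:[0,\infty)\to[0,\infty)$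 with $a(0)=0$; $K_\infty$ is the class of those $a\in K$ with $\lim_{r\to\infty}a(r)=\infty$; and $KL$ is the class of continuous $\sigma:[0,\infty)^2\to[0,\infty)$ such that $\sigma(\cdot,t)\in K$ for each $t\ge0$ and $\sigma(r,\cdot)$ is non-increasing with limit $0$ at infinity for each $r\ge0$. -/

import Mathlib

open Set Filter Topology

noncomputable section

namespace OpenRoad

/-! ### Comparison functions -/

/-- Class `K`: continuous, (strictly) increasing functions on `[0, ∞)` vanishing at `0`.
Only the values on `[0, ∞)` matter. -/
structure IsClassK (a : ℝ → ℝ) : Prop where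
  continuousOn : ContinuousOn a (Ici 0)
  strictMonoOn : StrictMonoOn a (Ici 0)
  map_zero : a 0 = 0

/-- Class `K_∞`: unbounded functions of class `K`. -/
structure IsClassKInfty (a : ℝ → ℝ) : Prop extends IsClassK a where
  tendsto_atTop : Tendsto a atTop atTop

/-- Class `KL`. -/
structure IsClassKL (σ : ℝ → ℝ → ℝ) : Prop where
  continuousOn : ContinuousOn (fun p : ℝ × ℝ => σ p.1 p.2) (Ici 0 ×ˢ Ici 0)
  classK : ∀ t, 0 ≤ t → IsClassK (fun s => σ s t)
  antitoneOn : ∀ s, 0 ≤ s → AntitoneOn (fun t => σ s t) (Ici 0)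
  tendsto_zero : ∀ s, 0 ≤ s → Tendsto (fun t => σ s t) atTop (𝓝 0)

/-! ### Autonomous differential equations on a subset of the state space -/

/-- The time interval `[0, T)`, where `T` may be `+∞`. -/
def timeInterval (T : EReal) : Set ℝ := {t : ℝ | 0 ≤ t ∧ (t : EReal) < T}

section ODE

variable {X : Type*} [NormedAddCommGroup X] [NormedSpace ℝ X]

/-- `x` is a solution on `[0, T)` of `x' = F x`, `x ∈ D` (values of `x` off `[0, T)` are
irrelevant; the derivative at time `0` is the right one). -/
def IsSolution (D : Set X) (F : X → X) (T : EReal) (x : ℝ → X) : Prop :=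
  0 < T ∧ ∀ t ∈ timeInterval T, x t ∈ D ∧ HasDerivWithinAt x (F (x t)) (timeInterval T) t

/-- A solution on `[0, T)` that is not the restriction of a solution on a longer interval. -/
def IsMaximalSolution (D : Set X) (F : X → X) (T : EReal) (x : ℝ → X) : Prop :=
  IsSolution D F T x ∧
    ∀ (T' : EReal) (y : ℝ → X), T ≤ T' → IsSolution D F T' y → EqOn y x (timeInterval T) → T' = T

end ODE

/-! ### Data of the cruise controller -/

/-- The constants and functions that enter the cruise controller. -/
structure Controller where
  /-- safety distance -/
  L : ℝ
  /-- interaction distance -/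
  lam : ℝ
  /-- speed limit -/
  vmax : ℝ
  /-- desired speed -/
  vstar : ℝ
  /-- friction gain -/
  μ : ℝ
  /-- repulsive potential, of which only the values on `(L, ∞)` matter -/
  V : ℝ → ℝ
  /-- the function shaping the spacing-dependent desired speed -/
  b : ℝ → ℝ
  L_pos : 0 < L
  L_lt_lam : L < lam
  vstar_pos : 0 < vstar
  vstar_lt_vmax : vstar < vmax
  μ_pos : 0 < μ
  V_contDiffOn : ContDiffOn ℝ 3 V (Ioi L)
  V_nonneg : ∀ x, L < x → 0 ≤ V x
  V_tendsto : Tendsto V (𝓝[>] L) atTop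
  V_eq_zero : ∀ x, lam ≤ x → V x = 0
  V_deriv_neg : ∀ x ∈ Ioo L lam, deriv V x < 0
  V_deriv2_pos : ∀ x ∈ Ioo L lam, 0 < deriv (deriv V) x
  b_contDiff : ContDiff ℝ 2 b
  b_strictMono : StrictMono b
  b_mem : ∀ x, b x ∈ Ioo (vstar - vmax) vstar
  b_zero : b 0 = 0
  b_sign : ∀ x, x ≠ 0 → 0 < x * b x
  b_deriv_zero_pos : 0 < deriv b 0

/-! ### The state space -/

/-- The Euclidean space `ℝ^(2n-1)` of all `(s₂, …, sₙ, v₁, …, vₙ)`. -/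
abbrev State (n : ℕ) : Type := EuclideanSpace ℝ (Finset.Icc 2 n ⊕ Finset.Icc 1 n)

variable {n : ℕ}

/-- The spacing `sᵢ`, `2 ≤ i ≤ n` (a dummy value for other `i`). -/
def spacing (x : State n) (i : ℕ) : ℝ :=
  if h : i ∈ Finset.Icc 2 n then x (Sum.inl ⟨i, h⟩) else 0

/-- The speed `vᵢ`, `1 ≤ i ≤ n` (a dummy value for other `i`; below, `v₀` and `vₙ₊₁` only occur
multiplied by `0`). -/
def speed (x : State n) (i : ℕ) : ℝ :=
  if h : i ∈ Finset.Icc 1 n then x (Sum.inr ⟨i, h⟩) else 0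

namespace Controller

variable (c : Controller)

/-- The state space `Ω_S` of the open road. -/
def stateSpace (n : ℕ) : Set (State n) :=
  {x | (∀ i ∈ Finset.Icc 2 n, c.L < spacing x i) ∧
    ∀ i ∈ Finset.Icc 1 n, 0 < speed x i ∧ speed x i < c.vmax}

/-- The set `E_S`: all spacings at least `λ`, all speeds equal to the desired speed. -/
def eqSet (n : ℕ) : Set (State n) :=
  {x | (∀ i ∈ Finset.Icc 2 n, c.lam ≤ spacing x i) ∧
    ∀ i ∈ Finset.Icc 1 n, speed x i = c.vstar}

/-! ### The controller -/

/-- `V'(sᵢ)`, with the convention `V'(s₁) = V'(sₙ₊₁) = 0`. -/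
def dV (x : State n) (i : ℕ) : ℝ :=
  if i ∈ Finset.Icc 2 n then deriv c.V (spacing x i) else 0

/-- `V''(sᵢ)`, with the convention `V''(s₁) = V''(sₙ₊₁) = 0`. -/
def d2V (x : State n) (i : ℕ) : ℝ :=
  if i ∈ Finset.Icc 2 n then deriv (deriv c.V) (spacing x i) else 0

/-- The spacing-dependent desired speed `fᵢ(s)`. -/
def desired (x : State n) (i : ℕ) : ℝ :=
  c.vstar - c.b (c.dV x (i + 1) - c.dV x i)

/-- The function `β(v, y)`. -/
def beta (v y : ℝ) : ℝ :=
  (c.vmax ^ 3 * (v + y) - 2 * c.vmax ^ 2 * y * v) / (2 * (c.vmax - v) ^ 2 * v ^ 2)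

/-- The viscous term `Zᵢ(s, v)`. -/
def viscous (x : State n) (i : ℕ) : ℝ :=
  -c.vmax ^ 2 * deriv c.b (c.dV x (i + 1) - c.dV x i) *
    (c.d2V x (i + 1) * (speed x i - speed x (i + 1)) -
      c.d2V x i * (speed x (i - 1) - speed x i))

/-- The acceleration `Fᵢ(s, v)` prescribed by the controller. -/
def accel (x : State n) (i : ℕ) : ℝ :=
  1 / c.beta (speed x i) (c.desired x i) *
    ((c.viscous x i - c.μ * c.vmax ^ 2 * (speed x i - c.desired x i)) /
        (speed x i * (c.vmax - speed x i)) +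
      c.dV x i - c.dV x (i + 1))

/-- The closed-loop vector field: `sᵢ' = vᵢ₋₁ - vᵢ` and `vᵢ' = Fᵢ(s, v)`. -/
def field (x : State n) : State n :=
  WithLp.toLp 2 (Sum.elim
    (fun i : Finset.Icc 2 n => speed x ((i : ℕ) - 1) - speed x i)
    (fun i : Finset.Icc 1 n => c.accel x i))

/-- The Lyapunov function `H_S(s, v)`. -/
def lyap (x : State n) : ℝ :=
  c.vmax ^ 2 / 2 *
      ∑ i ∈ Finset.Icc 1 n,
        (speed x i - c.desired x i) ^ 2 / (speed x i * (c.vmax - speed x i)) +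
    ∑ i ∈ Finset.Icc 2 n, c.V (spacing x i)

end Controller

end OpenRoad

end

open OpenRoad

noncomputable section

namespace OpenRoad

/-! The function `H_S` is a strict Lyapunov function. The factor `β` is chosen so that `β(vᵢ, fᵢ)(vᵢ
- fᵢ) = ∂H_S/∂vᵢ` with `fᵢ` held fixed, and `Zᵢ / v_max²` is the time derivative of `fᵢ`. Put `gᵢ =
V'(sᵢ₊₁) - V'(sᵢ)`. Summation by parts turns the potential's contribution into `∑ vᵢ gᵢ`, and `∑ gᵢ
= 0` removes `v*`. What remains is `H_S' = -μ v_max² ∑ (vᵢ - fᵢ)² / (vᵢ (v_max - vᵢ)) - ∑ gᵢ b(gᵢ)`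
(`energy_balance`, `hasDerivWithinAt_lyap`).

This dissipation is at least `α(H_S)` for a nondecreasing `α` positive off `0`
(`decayRate_le_dissipation`): either the kinetic half of `H_S` dominates, or some `V(sⱼ)` is large,
hence by convexity `|V'(sⱼ)|` is large, hence by telescoping some `|gᵢ|` is large. Thus `H_S(t) + t
α(H_S(t)) ≤ H_S(0)`, which gives the `KL` bound.

Sublevel sets of `H_S` stay away from the boundary of `Ω_S`, and spacings grow at most linearly in
time, so maximal solutions are global. At an equilibrium the energy balance forces zero dissipation,
so `H_S = 0`, which means membership in `E_S`. The lower bound `ā` exists because the distance to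
`E_S` is bounded on `Ω_S` and is small where `H_S` is small. -/

/-! ### Construction of comparison functions -/

/-- A nonincreasing quantity `h` with `h' ≤ -α(h)` satisfies `h t + t α(h t) ≤ h 0`; solving this
inequality for `h t` yields a class `KL` bound. -/
theorem exists_isClassKL {α : ℝ → ℝ} (hc : ContinuousOn α (Ici 0)) (hm : MonotoneOn α (Ici 0))
    (h0 : α 0 = 0) (hp : ∀ y, 0 < y → 0 < α y) :
    ∃ σ : ℝ → ℝ → ℝ, IsClassKL σ ∧
      ∀ r t y, 0 ≤ t → 0 ≤ y → y + t * α y ≤ r → y ≤ σ r t := by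
  have hα : ∀ y, 0 ≤ y → 0 ≤ α y := fun y hy => by
    rcases hy.eq_or_lt with rfl | h
    · exact h0.ge
    · exact (hp y h).le
  have key : ∀ r t : ℝ, ∃ y, 0 ≤ r → 0 ≤ t → 0 ≤ y ∧ y + t * α y = r := by
    intro r t
    by_cases hrt : 0 ≤ r ∧ 0 ≤ t
    · obtain ⟨hr, ht⟩ := hrt
      have hcont : ContinuousOn (fun y => y + t * α y) (Icc 0 r) :=
        continuousOn_id.add (continuousOn_const.mul (hc.mono Icc_subset_Ici_self))
      have := intermediate_value_Icc hr hcont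
      obtain ⟨y, hy, hyr⟩ := this (show r ∈ Icc _ _ from
        ⟨by simp [h0, hr], by nlinarith [mul_nonneg ht (hα r hr)]⟩)
      exact ⟨y, fun _ _ => ⟨hy.1, hyr⟩⟩
    · exact ⟨0, fun h1 h2 => (hrt ⟨h1, h2⟩).elim⟩
  -- `σ r t` is the root `y ≥ 0` of `y + t α(y) = r`, unique because the left side is strictly
  -- increasing in `y`.
  choose σ hσ using key
  have cmp : ∀ t y z, 0 ≤ t → 0 ≤ y → 0 ≤ z → y + t * α y ≤ z + t * α z → y ≤ z := by
    intro t y z ht hy hz h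
    by_contra! hlt
    have := mul_le_mul_of_nonneg_left (hm hz hy hlt.le) ht
    linarith
  -- By monotonicity `y - z` and `α y - α z` never have opposite signs, so adding the second cannot
  -- shrink the first.
  have lip : ∀ t y z, 0 ≤ t → 0 ≤ y → 0 ≤ z → |y - z| ≤ |(y - z) + t * (α y - α z)| := by
    intro t y z ht hy hz
    rcases le_total y z with h | h
    · have := mul_le_mul_of_nonneg_left (hm hy hz h) ht
      rw [abs_of_nonpos (by linarith), abs_of_nonpos (by nlinarith)]
      linarith
    · have := mul_le_mul_of_nonneg_left (hm hz hy h) ht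
      rw [abs_of_nonneg (by linarith), abs_of_nonneg (by nlinarith)]
      linarith
  have hcont : ContinuousOn (fun p : ℝ × ℝ => σ p.1 p.2) (Ici 0 ×ˢ Ici 0) := by
    rintro ⟨r0, t0⟩ ⟨hr0, ht0⟩
    simp only [mem_Ici] at hr0 ht0
    obtain ⟨hz, hz'⟩ := hσ r0 t0 hr0 ht0
    have hlim : Tendsto (fun p : ℝ × ℝ => |p.1 - r0 - (p.2 - t0) * α (σ r0 t0)|)
        (𝓝[Ici 0 ×ˢ Ici 0] (r0, t0)) (𝓝 0) := by
      have : Continuous (fun p : ℝ × ℝ => |p.1 - r0 - (p.2 - t0) * α (σ r0 t0)|) := by fun_prop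
      have := this.tendsto (r0, t0)
      simp only [sub_self, zero_mul, abs_zero] at this
      exact this.mono_left nhdsWithin_le_nhds
    rw [ContinuousWithinAt, tendsto_iff_dist_tendsto_zero]
    refine squeeze_zero' (Eventually.of_forall fun _ => dist_nonneg) ?_ hlim
    filter_upwards [self_mem_nhdsWithin] with p hp'
    obtain ⟨hy, hy'⟩ := hσ p.1 p.2 hp'.1 hp'.2
    rw [Real.dist_eq]
    refine (lip p.2 _ _ hp'.2 hy hz).trans (le_of_eq ?_)
    congr 1
    linear_combination hy' - hz'
  refine ⟨σ, ⟨hcont, ?_, ?_, ?_⟩, ?_⟩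
  · intro t ht
    refine ⟨?_, ?_, ?_⟩
    · exact hcont.comp (f := fun s : ℝ => (s, t)) (by fun_prop) (fun s hs => ⟨hs, ht⟩)
    · intro r1 h1 r2 h2 hlt
      obtain ⟨a1, b1⟩ := hσ r1 t h1 ht
      obtain ⟨a2, b2⟩ := hσ r2 t h2 ht
      by_contra! hle
      have := mul_le_mul_of_nonneg_left (hm a2 a1 hle) ht
      linarith
    · obtain ⟨a1, b1⟩ := hσ 0 t le_rfl ht
      have := mul_nonneg ht (hα _ a1)
      linarith
  · intro r hr t1 h1 t2 h2 hle
    obtain ⟨a1, b1⟩ := hσ r t1 hr h1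
    obtain ⟨a2, b2⟩ := hσ r t2 hr h2
    refine cmp t1 _ _ h1 a2 a1 ?_
    have := mul_le_mul_of_nonneg_right hle (hα _ a2)
    linarith
  · intro r hr
    rw [Metric.tendsto_atTop]
    intro ε hε
    refine ⟨r / α ε + 1, fun t ht => ?_⟩
    have ht0 : 0 ≤ t := le_trans (by have := div_nonneg hr (hp ε hε).le; linarith) ht
    obtain ⟨a1, b1⟩ := hσ r t hr ht0
    rw [Real.dist_eq, sub_zero, abs_of_nonneg a1]
    by_contra! hle
    -- A root at least `ε` would need `t α(ε) ≤ r`, which fails once `t > r / α(ε)`.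
    have h1 := mul_le_mul_of_nonneg_left (hm hε.le a1 hle) ht0
    have h2 : r < t * α ε := by
      rw [← div_lt_iff₀ (hp ε hε)]
      linarith
    linarith
  · intro r t y ht hy hle
    have hr : 0 ≤ r := le_trans (by have := mul_nonneg ht (hα y hy); linarith) hle
    obtain ⟨a1, b1⟩ := hσ r t hr ht
    exact cmp t _ _ ht hy a1 (by linarith)

/-- If a bounded function `d` is small wherever `h` is small, then `a ∘ d ≤ h` for some `a` of
class `K_∞`. -/
theorem exists_isClassKInfty {X : Type*} (D : Set X) (d h : X → ℝ) (R : ℝ)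
    (hd : ∀ x ∈ D, 0 ≤ d x) (hdR : ∀ x ∈ D, d x ≤ R) (hh : ∀ x ∈ D, 0 ≤ h x)
    (hsmall : ∀ ε > 0, ∃ δ > 0, ∀ x ∈ D, h x < δ → d x < ε) :
    ∃ a, IsClassKInfty a ∧ ∀ x ∈ D, a (d x) ≤ h x := by
  -- `m r` is the best threshold `δ` guaranteeing `d < r`; the cap at `1` keeps the supremum finite.
  -- It satisfies `m (d x) ≤ h x` but may jump or be locally constant, so it is replaced by the
  -- primitive `r ↦ (1/Q) ∫₀ʳ m`. As `m` is nondecreasing, this is at most `(r/Q) m r`, hence at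
  -- most `m r` when `r ≤ Q`.
  let S : ℝ → Set ℝ := fun r => {δ | δ ∈ Icc 0 1 ∧ ∀ x ∈ D, h x < δ → d x < r}
  let m : ℝ → ℝ := fun r => sSup (S r)
  have hS0 : ∀ r, (0 : ℝ) ∈ S r := fun r =>
    ⟨⟨le_rfl, zero_le_one⟩, fun x hx hlt => absurd hlt (hh x hx).not_gt⟩
  have hSb : ∀ r, BddAbove (S r) := fun r => ⟨1, fun δ hδ => hδ.1.2⟩
  have hm : Monotone m := fun r1 r2 hle =>
    csSup_le_csSup (hSb r2) ⟨0, hS0 r1⟩ fun δ hδ =>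
      ⟨hδ.1, fun x hx hlt => (hδ.2 x hx hlt).trans_le hle⟩
  have hm0 : ∀ r, 0 ≤ m r := fun r => le_csSup (hSb r) (hS0 r)
  have hmpos : ∀ r, 0 < r → 0 < m r := fun r hr => by
    obtain ⟨δ, hδ, hx⟩ := hsmall r hr
    refine lt_of_lt_of_le (lt_min hδ one_pos) (le_csSup (hSb r) ⟨⟨?_, min_le_right _ _⟩, ?_⟩)
    · exact (lt_min hδ one_pos).le
    · exact fun x hxD hlt => hx x hxD (hlt.trans_le (min_le_left _ _))
  have hmh : ∀ x ∈ D, m (d x) ≤ h x := fun x hx => by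
    refine csSup_le ⟨0, hS0 _⟩ fun δ hδ => ?_
    by_contra! hlt
    exact lt_irrefl _ (hδ.2 x hx hlt)
  set Q : ℝ := max R 1 with hQ
  have hQ0 : 0 < Q := lt_max_of_lt_right one_pos
  have hint : ∀ p q, IntervalIntegrable m MeasureTheory.volume p q := fun p q =>
    hm.intervalIntegrable
  have hdiff : ∀ p q, p ≤ q → (q - p) * m p ≤ (∫ u in (0:ℝ)..q, m u) - ∫ u in (0:ℝ)..p, m u := by
    intro p q hpq
    rw [intervalIntegral.integral_interval_sub_left (hint _ _) (hint _ _)]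
    have := intervalIntegral.integral_mono_on hpq (intervalIntegrable_const (c := m p)) (hint p q)
      (fun u hu => hm hu.1)
    simpa using this
  have hmono : ∀ p q, p ≤ q → (∫ u in (0:ℝ)..p, m u) ≤ ∫ u in (0:ℝ)..q, m u := fun p q hpq => by
    have := hdiff p q hpq
    have := mul_nonneg (sub_nonneg.2 hpq) (hm0 p)
    linarith
  refine ⟨fun r => (∫ u in (0:ℝ)..r, m u) / Q, ⟨⟨?_, ?_, by simp⟩, ?_⟩, ?_⟩
  · exact ((intervalIntegral.continuous_primitive hint 0).div_const Q).continuousOn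
  · intro p hp q hq hpq
    have hp' : (0 : ℝ) ≤ p := hp
    refine div_lt_div_of_pos_right ?_ hQ0
    -- The midpoint is used since `m p` may vanish at `p = 0`.
    have h1 := hmono p ((p + q) / 2) (by linarith)
    have h2 := hdiff ((p + q) / 2) q (by linarith)
    have h3 : 0 < (q - (p + q) / 2) * m ((p + q) / 2) :=
      mul_pos (by linarith) (hmpos _ (by linarith))
    linarith
  · refine Tendsto.atTop_div_const hQ0 ?_
    refine tendsto_atTop_mono' _ (f₁ := fun r => (r - 1) * m 1) ?_ ?_
    · filter_upwards [eventually_ge_atTop 1] with r hr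
      have h1 := hdiff 1 r hr
      have h2 := hmono 0 1 zero_le_one
      simp only [intervalIntegral.integral_same] at h2
      linarith
    · exact (tendsto_atTop_add_const_right _ (-1) tendsto_id).atTop_mul_const (hmpos 1 one_pos)
  · intro x hx
    refine le_trans ?_ (hmh x hx)
    rw [div_le_iff₀ hQ0]
    have h1 := intervalIntegral.integral_mono_on (hd x hx) (hint 0 (d x))
      (intervalIntegrable_const (c := m (d x))) (fun u hu => hm hu.2)
    rw [intervalIntegral.integral_const, sub_zero, smul_eq_mul] at h1
    have h2 : d x ≤ Q := (hdR x hx).trans (le_max_left _ _)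
    nlinarith [hm0 (d x)]

/-! ### Maximal solutions -/

theorem timeInterval_mono {S T : EReal} (h : S ≤ T) : timeInterval S ⊆ timeInterval T :=
  fun _ ht => ⟨ht.1, ht.2.trans_le h⟩

theorem timeInterval_coe (T : ℝ) : timeInterval T = Ico 0 T := by
  ext t
  simp [timeInterval]

theorem Icc_subset_timeInterval {T : EReal} {t : ℝ} (ht : t ∈ timeInterval T) :
    Icc 0 t ⊆ timeInterval T :=
  fun _ hs => ⟨hs.1, (EReal.coe_le_coe_iff.2 hs.2).trans_lt ht.2⟩

/-- A time interval contains, near each of its points, all nonnegative times. -/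
theorem timeInterval_mem_nhdsWithin {T : EReal} {t : ℝ} (ht : t ∈ timeInterval T) :
    timeInterval T ∈ 𝓝[Ici 0] t := by
  have h : {s : ℝ | (s : EReal) < T} ∈ 𝓝 t :=
    (isOpen_Iio.preimage continuous_coe_real_ereal).mem_nhds ht.2
  filter_upwards [self_mem_nhdsWithin, mem_nhdsWithin_of_mem_nhds h] with s hs hs'
  exact ⟨hs, hs'⟩

section ODE

variable {X : Type*} [NormedAddCommGroup X] [NormedSpace ℝ X]

/-- Replaces the interval by `[0, ∞)`, so that derivatives on intervals of different length can be
compared. -/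
theorem hasDerivWithinAt_timeInterval_iff {T : EReal} {t : ℝ} (ht : t ∈ timeInterval T)
    {x : ℝ → X} {x' : X} :
    HasDerivWithinAt x x' (timeInterval T) t ↔ HasDerivWithinAt x x' (Ici 0) t :=
  ⟨fun h => h.mono_of_mem_nhdsWithin (timeInterval_mem_nhdsWithin ht),
    fun h => h.mono fun _ hs => hs.1⟩

/-- Every solution is the restriction of a maximal one. -/
theorem IsSolution.exists_isMaximalSolution {D : Set X} {F : X → X} {T : EReal} {x : ℝ → X}
    (hx : IsSolution D F T x) :
    ∃ (S : EReal) (y : ℝ → X), IsMaximalSolution D F S y ∧ T ≤ S ∧ EqOn y x (timeInterval T) := by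
  classical
  let P : Type _ := {p : EReal × (ℝ → X) // IsSolution D F p.1 p.2 ∧ T ≤ p.1 ∧
    EqOn p.2 x (timeInterval T)}
  -- Zorn's lemma for extension of solutions. This is only a preorder, since values off the interval
  -- are free; a chain is bounded by the union of its members on the supremum of their end times.
  let r : P → P → Prop := fun p q => p.1.1 ≤ q.1.1 ∧ EqOn q.1.2 p.1.2 (timeInterval p.1.1)
  have htrans : ∀ {p q s : P}, r p q → r q s → r p s := fun {p q s} h1 h2 =>
    ⟨h1.1.trans h2.1, (h2.2.mono (timeInterval_mono h1.1)).trans h1.2⟩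
  have : Nonempty P := ⟨⟨(T, x), hx, le_rfl, fun _ _ => rfl⟩⟩
  obtain ⟨m, hm⟩ := exists_maximal_of_nonempty_chains_bounded (r := r) (fun C hC hne => by
    obtain ⟨p0, hp0⟩ := hne
    let S : EReal := ⨆ p ∈ C, (p : P).1.1
    have hS : ∀ p ∈ C, p.1.1 ≤ S := fun p hp => le_iSup₂ (f := fun (p : P) (_ : p ∈ C) => p.1.1) p hp
    have hex : ∀ t ∈ timeInterval S, ∃ p ∈ C, t ∈ timeInterval p.1.1 := fun t ht => by
      obtain ⟨p, hp⟩ := lt_iSup_iff.1 ht.2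
      obtain ⟨hpC, hp⟩ := lt_iSup_iff.1 hp
      exact ⟨p, hpC, ht.1, hp⟩
    have hcompat : ∀ p ∈ C, ∀ q ∈ C, ∀ t ∈ timeInterval p.1.1, t ∈ timeInterval q.1.1 →
        p.1.2 t = q.1.2 t := fun p hp q hq t htp htq => by
      by_cases hpq : p = q
      · rw [hpq]
      · rcases hC hp hq hpq with h | h
        · exact (h.2 htp).symm
        · exact h.2 htq
    let z : ℝ → X := fun t =>
      if h : ∃ p ∈ C, t ∈ timeInterval p.1.1 then h.choose.1.2 t else 0
    have hz : ∀ p ∈ C, ∀ t ∈ timeInterval p.1.1, z t = p.1.2 t := fun p hp t ht => by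
      have h : ∃ p ∈ C, t ∈ timeInterval p.1.1 := ⟨p, hp, ht⟩
      simp only [z, dif_pos h]
      exact hcompat _ h.choose_spec.1 _ hp _ h.choose_spec.2 ht
    refine ⟨⟨(S, z), ⟨?_, ?_⟩, ?_, ?_⟩, ?_⟩
    · exact p0.2.1.1.trans_le (hS p0 hp0)
    · intro t ht
      obtain ⟨p, hp, htp⟩ := hex t ht
      have hsol := p.2.1.2 t htp
      simp only
      rw [hz p hp t htp]
      refine ⟨hsol.1, ?_⟩
      rw [hasDerivWithinAt_timeInterval_iff ht, ← hasDerivWithinAt_timeInterval_iff htp]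
      exact hsol.2.congr (hz p hp) (hz p hp t htp)
    · exact p0.2.2.1.trans (hS p0 hp0)
    · intro t ht
      exact (hz p0 hp0 t (timeInterval_mono p0.2.2.1 ht)).trans (p0.2.2.2 ht)
    · exact fun p hp => ⟨hS p hp, hz p hp⟩) htrans
  refine ⟨m.1.1, m.1.2, ⟨m.2.1, fun T' y hle hy heq => ?_⟩, m.2.2.1, m.2.2.2⟩
  have := hm ⟨(T', y), hy, m.2.2.1.trans hle,
    (heq.mono (timeInterval_mono m.2.2.1)).trans m.2.2.2⟩ ⟨hle, heq⟩
  exact le_antisymm this.1 hle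

/-- Local existence: a `C¹` vector field on an open set has a solution through each point. -/
theorem exists_local_solution [CompleteSpace X] {D : Set X} {F : X → X} (hD : IsOpen D) (hF : ContDiffOn ℝ 1 F D)
    {p : X} (hp : p ∈ D) (t₀ : ℝ) :
    ∃ z : ℝ → X, z t₀ = p ∧ ∃ ε > (0 : ℝ), ∀ t ∈ Ioo (t₀ - ε) (t₀ + ε),
      z t ∈ D ∧ HasDerivAt z (F (z t)) t := by
  obtain ⟨z, hz0, ε, hε, hz⟩ :=
    (hF.contDiffAt (hD.mem_nhds hp)).exists_forall_mem_closedBall_exists_eq_forall_mem_Ioo_hasDerivAt₀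
      t₀
  have hcont : ContinuousAt z t₀ := (hz t₀ ⟨by linarith, by linarith⟩).continuousAt
  have hmem : z ⁻¹' D ∈ 𝓝 t₀ := hcont (hD.mem_nhds (hz0 ▸ hp))
  obtain ⟨δ, hδ, hball⟩ := Metric.mem_nhds_iff.1 hmem
  refine ⟨z, hz0, min ε δ, lt_min hε hδ, fun t ht => ⟨hball ?_, hz t ?_⟩⟩
  · rw [Real.ball_eq_Ioo]
    have := min_le_right ε δ
    exact ⟨by linarith [ht.1], by linarith [ht.2]⟩
  · have := min_le_left ε δ
    exact ⟨by linarith [ht.1], by linarith [ht.2]⟩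

theorem exists_isSolution [CompleteSpace X] {D : Set X} {F : X → X} (hD : IsOpen D) (hF : ContDiffOn ℝ 1 F D)
    {p : X} (hp : p ∈ D) : ∃ (T : EReal) (x : ℝ → X), IsSolution D F T x ∧ x 0 = p := by
  obtain ⟨z, hz0, ε, hε, hz⟩ := exists_local_solution hD hF hp 0
  refine ⟨(ε : ℝ), z, ⟨by exact_mod_cast hε, fun t ht => ?_⟩, hz0⟩
  rw [timeInterval_coe] at ht
  have := hz t ⟨by linarith [ht.1], by linarith [ht.2]⟩
  exact ⟨this.1, this.2.hasDerivWithinAt⟩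

/-- A solution on `[0, T)` that stays in a compact subset of the domain converges as `t → T`. -/
theorem IsSolution.exists_tendsto {D : Set X} {F : X → X} (hF : ContinuousOn F D) {T : ℝ}
    {x : ℝ → X} (hx : IsSolution D F T x) {K : Set X} (hK : IsCompact K) (hKD : K ⊆ D)
    (hxK : ∀ t ∈ Ico 0 T, x t ∈ K) : ∃ p ∈ K, Tendsto x (𝓝[<] T) (𝓝 p) := by
  have hT : 0 < T := by exact_mod_cast hx.1
  have hx2 := hx.2
  rw [timeInterval_coe] at hx2
  obtain ⟨M, hM⟩ := hK.exists_bound_of_continuousOn (hF.mono hKD)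
  -- The velocity is bounded on `K`, so `x` is Lipschitz; the Lipschitz estimate passes to a cluster
  -- point, which is therefore the limit.
  have hLip : ∀ s ∈ Ico 0 T, ∀ t ∈ Ico 0 T, ‖x t - x s‖ ≤ M * ‖t - s‖ := fun s hs t ht =>
    (convex_Ico 0 T).norm_image_sub_le_of_norm_hasDerivWithin_le (fun u hu => (hx2 u hu).2)
      (fun u hu => hM _ (hxK u hu)) hs ht
  have hIco : ∀ᶠ t in 𝓝[<] T, t ∈ Ico 0 T := by
    filter_upwards [Ioo_mem_nhdsLT hT] with t ht using ⟨ht.1.le, ht.2⟩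
  obtain ⟨p, hpK, hp⟩ := hK.exists_mapClusterPt (f := 𝓝[<] T) (u := x)
    (tendsto_principal.2 (hIco.mono hxK))
  have hpt : ∀ t ∈ Ico 0 T, ‖p - x t‖ ≤ M * (T - t) := fun t ht => by
    have hcl : IsClosed {y : X | ‖y - x t‖ ≤ M * (T - t)} :=
      isClosed_le (by fun_prop) continuous_const
    refine hcl.mem_of_mapClusterPt hp ?_
    have hM0 : 0 ≤ M := (norm_nonneg _).trans (hM _ (hxK t ht))
    filter_upwards [hIco, Ioo_mem_nhdsLT ht.2] with s hs hs'
    refine (hLip t ht s hs).trans ?_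
    rw [Real.norm_of_nonneg (by linarith [hs'.1])]
    exact mul_le_mul_of_nonneg_left (by linarith [hs.2]) hM0
  refine ⟨p, hpK, ?_⟩
  rw [tendsto_iff_norm_sub_tendsto_zero]
  refine squeeze_zero' (g := fun t => M * (T - t)) (Eventually.of_forall fun _ => norm_nonneg _) ?_ ?_
  · filter_upwards [hIco] with t ht
    rw [norm_sub_rev]
    exact hpt t ht
  · have : Continuous fun t : ℝ => M * (T - t) := by fun_prop
    have := this.tendsto T
    rw [sub_self, mul_zero] at this
    exact this.mono_left nhdsWithin_le_nhds

/-- A solution on `[0, T)` that stays in a compact subset of the domain can be continued. -/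
theorem IsSolution.exists_extension [CompleteSpace X] {D : Set X} {F : X → X} (hD : IsOpen D)
    (hF : ContDiffOn ℝ 1 F D) {T : ℝ} {x : ℝ → X} (hx : IsSolution D F T x) {K : Set X}
    (hK : IsCompact K) (hKD : K ⊆ D) (hxK : ∀ t ∈ Ico 0 T, x t ∈ K) :
    ∃ (ε : ℝ) (y : ℝ → X), 0 < ε ∧ IsSolution D F (T + ε : ℝ) y ∧
      EqOn y x (timeInterval T) := by
  have hT : 0 < T := by exact_mod_cast hx.1
  have hx2 := hx.2
  obtain ⟨p, hpK, hlim⟩ := hx.exists_tendsto hF.continuousOn hK hKD hxK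
  obtain ⟨z, hz0, ε, hε, hz⟩ := exists_local_solution hD hF (hKD hpK) T
  let y : ℝ → X := fun t => if t < T then x t else z t
  have hyx : ∀ t, t < T → y t = x t := fun t ht => if_pos ht
  have hyz : ∀ t, T ≤ t → y t = z t := fun t ht => if_neg ht.not_gt
  have hyT : y T = p := (hyz T le_rfl).trans hz0
  have hxd : ∀ t ∈ Ioo 0 T, HasDerivAt y (F (x t)) t := fun t ht => by
    have h1 := (hx2 t ⟨ht.1.le, by exact_mod_cast ht.2⟩).2
    rw [timeInterval_coe] at h1
    refine (h1.hasDerivAt (Ico_mem_nhds ht.1 ht.2)).congr_of_eventuallyEq ?_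
    filter_upwards [Iio_mem_nhds ht.2] with s hs using hyx s hs
  have hlim' : Tendsto y (𝓝[<] T) (𝓝 p) :=
    hlim.congr' (by filter_upwards [self_mem_nhdsWithin] with s hs using (hyx s hs).symm)
  -- At the junction the left derivative is the limit of the derivatives `F (x t)`, and it agrees
  -- with the right derivative of the local solution through `p`.
  have hleft : HasDerivWithinAt y (F p) (Iic T) T := by
    refine hasDerivWithinAt_Iic_of_tendsto_deriv (s := Ioo 0 T)
      (fun t ht => (hxd t ht).differentiableAt.differentiableWithinAt) ?_ (Ioo_mem_nhdsLT hT) ?_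
    · rw [ContinuousWithinAt, hyT]
      exact hlim'.mono_left (nhdsWithin_mono _ fun t ht => ht.2)
    · have hFp : ContinuousAt F p := hF.continuousOn.continuousAt (hD.mem_nhds (hKD hpK))
      refine (hFp.tendsto.comp hlim).congr' ?_
      filter_upwards [Ioo_mem_nhdsLT hT] with t ht using (hxd t ht).deriv.symm
  have hright : HasDerivWithinAt y (F p) (Ici T) T := by
    have h1 := (hz T ⟨by linarith, by linarith⟩).2
    rw [hz0] at h1
    exact h1.hasDerivWithinAt.congr (fun t ht => hyz t ht) (hyz T le_rfl)
  refine ⟨ε, y, hε, ⟨by exact_mod_cast (by linarith : 0 < T + ε), fun t ht => ?_⟩, fun t ht => ?_⟩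
  · rw [hasDerivWithinAt_timeInterval_iff ht]
    rw [timeInterval_coe] at ht
    rcases lt_trichotomy t T with h | rfl | h
    · have htT : t ∈ timeInterval T := ⟨ht.1, by exact_mod_cast h⟩
      obtain ⟨h1, h2⟩ := hx2 t htT
      rw [hasDerivWithinAt_timeInterval_iff htT] at h2
      rw [hyx t h]
      refine ⟨h1, h2.congr_of_eventuallyEq ?_ (hyx t h)⟩
      filter_upwards [mem_nhdsWithin_of_mem_nhds (Iio_mem_nhds h)] with s hs using hyx s hs
    · rw [hyT]
      refine ⟨hKD hpK, HasDerivAt.hasDerivWithinAt ?_⟩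
      have := hleft.union hright
      rwa [Iic_union_Ici, hasDerivWithinAt_univ] at this
    · obtain ⟨h1, h2⟩ := hz t ⟨by linarith, ht.2⟩
      rw [hyz t h.le]
      refine ⟨h1, HasDerivAt.hasDerivWithinAt (h2.congr_of_eventuallyEq ?_)⟩
      filter_upwards [Ioi_mem_nhds h] with s hs using hyz s (le_of_lt hs)
  · rw [timeInterval_coe] at ht
    exact hyx t ht.2

/-- A maximal solution whose values stay, in finite time, in compact subsets of the domain is
global. -/
theorem IsMaximalSolution.eq_top [CompleteSpace X] {D : Set X} {F : X → X} (hD : IsOpen D)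
    (hF : ContDiffOn ℝ 1 F D) {T : EReal} {x : ℝ → X} (hx : IsMaximalSolution D F T x)
    (hcpt : ∀ S : ℝ, ∃ K ⊆ D, IsCompact K ∧ ∀ t ∈ timeInterval T, t ≤ S → x t ∈ K) :
    T = ⊤ := by
  by_contra hne
  have hbot : T ≠ ⊥ := (bot_lt_iff_ne_bot.1 (bot_le.trans_lt hx.1.1))
  lift T to ℝ using ⟨hne, hbot⟩
  obtain ⟨K, hKD, hK, hxK⟩ := hcpt T
  obtain ⟨ε, y, hε, hy, heq⟩ := hx.1.exists_extension hD hF hK hKD fun t ht =>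
    hxK t (by rwa [timeInterval_coe]) ht.2.le
  have := hx.2 _ y (by exact_mod_cast (by linarith : T ≤ T + ε)) hy heq
  rw [EReal.coe_eq_coe_iff] at this
  linarith

end ODE

variable {n : ℕ}

namespace Controller

variable (c : Controller)

/-! ### The potential and the function `b` -/

theorem contDiffOn_deriv_V : ContDiffOn ℝ 2 (deriv c.V) (Ioi c.L) :=
  c.V_contDiffOn.deriv_of_isOpen isOpen_Ioi (by norm_num)

theorem contDiffOn_deriv2_V : ContDiffOn ℝ 1 (deriv (deriv c.V)) (Ioi c.L) :=
  c.contDiffOn_deriv_V.deriv_of_isOpen isOpen_Ioi (by norm_num)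

theorem hasDerivAt_V {s : ℝ} (hs : c.L < s) : HasDerivAt c.V (deriv c.V s) s :=
  ((c.V_contDiffOn.contDiffAt (Ioi_mem_nhds hs)).differentiableAt (by norm_num)).hasDerivAt

theorem hasDerivAt_deriv_V {s : ℝ} (hs : c.L < s) :
    HasDerivAt (deriv c.V) (deriv (deriv c.V) s) s :=
  ((c.contDiffOn_deriv_V.contDiffAt (Ioi_mem_nhds hs)).differentiableAt (by norm_num)).hasDerivAt

theorem continuousOn_V : ContinuousOn c.V (Ioi c.L) := c.V_contDiffOn.continuousOn

/-- At `s = λ` the vanishing of `V` is only one-sided, but `V ≥ 0` makes every zero a local minimum.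
-/
theorem deriv_V_eq_zero {s : ℝ} (hs : c.lam ≤ s) : deriv c.V s = 0 := by
  refine IsLocalMin.deriv_eq_zero ?_
  filter_upwards [Ioi_mem_nhds (c.L_lt_lam.trans_le hs)] with t ht
  rw [c.V_eq_zero s hs]
  exact c.V_nonneg t ht

theorem deriv_V_nonpos {s : ℝ} (hs : c.L < s) : deriv c.V s ≤ 0 := by
  rcases lt_or_ge s c.lam with h | h
  · exact (c.V_deriv_neg s ⟨hs, h⟩).le
  · exact (c.deriv_V_eq_zero h).le

/-- The sign of `V''` is prescribed only below `λ`; beyond it, `V' = 0` is the largest value that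
`V'` can take. -/
theorem monotoneOn_deriv_V : MonotoneOn (deriv c.V) (Ioi c.L) := by
  intro s hs t ht hst
  rcases lt_or_ge t c.lam with h | h
  · refine (strictMonoOn_of_deriv_pos (convex_Ioo c.L c.lam)
      (c.contDiffOn_deriv_V.continuousOn.mono fun u hu => hu.1) ?_).monotoneOn
      ⟨hs, hst.trans_lt h⟩ ⟨ht, h⟩ hst
    rw [interior_Ioo]
    exact c.V_deriv2_pos
  · rw [c.deriv_V_eq_zero h]
    exact c.deriv_V_nonpos hs

theorem antitoneOn_V : AntitoneOn c.V (Ioi c.L) := by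
  refine antitoneOn_of_deriv_nonpos (convex_Ioi _) c.continuousOn_V ?_ ?_
  · rw [interior_Ioi]
    exact fun s hs => (c.hasDerivAt_V hs).differentiableAt.differentiableWithinAt
  · rw [interior_Ioi]
    exact fun s hs => c.deriv_V_nonpos hs

theorem exists_V_eq {s : ℝ} (hs : c.L < s) (hs' : s < c.lam) :
    ∃ ξ ∈ Ioo s c.lam, c.V s = -deriv c.V ξ * (c.lam - s) := by
  obtain ⟨ξ, hξ, h⟩ := exists_deriv_eq_slope c.V hs'
    (c.continuousOn_V.mono fun u hu => hs.trans_le hu.1)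
    (fun u hu => (c.hasDerivAt_V (hs.trans hu.1)).differentiableAt.differentiableWithinAt)
  refine ⟨ξ, hξ, ?_⟩
  have : c.lam - s ≠ 0 := by linarith
  rw [h, c.V_eq_zero _ le_rfl]
  field_simp
  ring

theorem V_pos {s : ℝ} (hs : c.L < s) (hs' : s < c.lam) : 0 < c.V s := by
  obtain ⟨ξ, hξ, h⟩ := c.exists_V_eq hs hs'
  rw [h]
  have := c.V_deriv_neg ξ ⟨hs.trans hξ.1, hξ.2⟩
  exact mul_pos (by linarith) (by linarith)

/-- Convexity: the mean slope between `s` and `λ` is at most the slope at `s`. -/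
theorem V_le_neg_deriv_mul {s : ℝ} (hs : c.L < s) : c.V s ≤ -deriv c.V s * (c.lam - c.L) := by
  rcases lt_or_ge s c.lam with h | h
  · obtain ⟨ξ, hξ, hV⟩ := c.exists_V_eq hs h
    rw [hV]
    have h1 := c.monotoneOn_deriv_V hs (hs.trans hξ.1) hξ.1.le
    have h2 := c.deriv_V_nonpos hs
    exact mul_le_mul (by linarith) (by linarith) (by linarith) (by linarith)
  · rw [c.V_eq_zero s h, c.deriv_V_eq_zero h]
    simp

/-- Take `s₀ < λ` close to `λ` and `δ = V(s₀) > 0`; since `V` is nonincreasing, `V(s) < δ` forces `s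
> s₀`. -/
theorem exists_forall_V_lt {ε : ℝ} (hε : 0 < ε) :
    ∃ δ > 0, ∀ s, c.L < s → c.V s < δ → c.lam - s < ε ∧ -deriv c.V s < ε := by
  have hcont : ContinuousAt (deriv c.V) c.lam :=
    c.contDiffOn_deriv_V.continuousOn.continuousAt (Ioi_mem_nhds c.L_lt_lam)
  have h1 : ∀ᶠ s in 𝓝[<] c.lam, -deriv c.V s < ε := by
    refine Eventually.filter_mono nhdsWithin_le_nhds (hcont.neg.eventually_lt_const ?_)
    simpa [c.deriv_V_eq_zero le_rfl] using hε
  have h2 : ∀ᶠ s in 𝓝[<] c.lam, s ∈ Ioo (max c.L (c.lam - ε)) c.lam :=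
    Ioo_mem_nhdsLT (max_lt c.L_lt_lam (by linarith))
  obtain ⟨s₀, hd, hs₀, hs₀'⟩ := (h1.and h2).exists
  obtain ⟨hL, hle⟩ := max_lt_iff.1 hs₀
  refine ⟨c.V s₀, c.V_pos hL hs₀', fun s hs hlt => ?_⟩
  have hss : s₀ < s := by
    by_contra! h
    exact hlt.not_ge (c.antitoneOn_V hs hL h)
  have := c.monotoneOn_deriv_V hL hs hss.le
  exact ⟨by linarith, by linarith⟩

/-- The blow-up of `V` at `L` keeps spacings uniformly away from collision at bounded energy. -/
theorem exists_forall_le_of_V_le (h : ℝ) :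
    ∃ l > c.L, ∀ s, c.L < s → c.V s ≤ h → l ≤ s := by
  obtain ⟨u, hu, hsub⟩ := mem_nhdsGT_iff_exists_Ioo_subset.1
    (c.V_tendsto.eventually_gt_atTop h)
  refine ⟨u, hu, fun s hs hV => ?_⟩
  by_contra! hlt
  exact hV.not_gt (hsub ⟨hs, hlt⟩)

theorem b_mul_self_nonneg (y : ℝ) : 0 ≤ y * c.b y := by
  by_cases hy : y = 0
  · simp [hy]
  · exact (c.b_sign y hy).le

theorem continuous_b : Continuous c.b := c.b_contDiff.continuous

theorem hasDerivAt_b (y : ℝ) : HasDerivAt c.b (deriv c.b y) y :=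
  (c.b_contDiff.differentiable (by norm_num) y).hasDerivAt

theorem contDiff_deriv_b : ContDiff ℝ 1 (deriv c.b) := by
  have h : ContDiff ℝ (1 + 1) c.b := by
    rw [one_add_one_eq_two]
    exact c.b_contDiff
  exact (contDiff_succ_iff_deriv.1 h).2.2

/-- The least value of `y b(y)` for `|y| ≥ r`. -/
def bGain (r : ℝ) : ℝ := min (r * c.b r) (-r * c.b (-r))

theorem continuous_bGain : Continuous c.bGain := by
  have := c.continuous_b
  unfold bGain
  fun_prop

theorem bGain_zero : c.bGain 0 = 0 := by simp [bGain]

theorem bGain_pos {r : ℝ} (hr : 0 < r) : 0 < c.bGain r :=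
  lt_min (c.b_sign r hr.ne') (c.b_sign (-r) (by linarith))

theorem bGain_le {r y : ℝ} (hr : 0 ≤ r) (hy : r ≤ |y|) : c.bGain r ≤ y * c.b y := by
  have hm := c.b_strictMono.monotone
  rcases le_total 0 y with h | h
  · rw [abs_of_nonneg h] at hy
    refine (min_le_left _ _).trans (mul_le_mul hy (hm hy) ?_ h)
    rw [← c.b_zero]
    exact hm hr
  · rw [abs_of_nonpos h] at hy
    refine (min_le_right _ _).trans ?_
    have h1 : c.b y ≤ c.b (-r) := hm (by linarith)
    have h2 : c.b (-r) ≤ 0 := by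
      rw [← c.b_zero]
      exact hm (by linarith)
    nlinarith

theorem monotoneOn_bGain : MonotoneOn c.bGain (Ici 0) := by
  intro r hr s hs hrs
  have hr' : (0 : ℝ) ≤ r := hr
  have hs' : (0 : ℝ) ≤ s := hs
  refine le_min (c.bGain_le hr ?_) (c.bGain_le hr ?_)
  · rwa [abs_of_nonneg hs']
  · rwa [abs_neg, abs_of_nonneg hs']

end Controller

/-! ### Sums over the string of vehicles -/

theorem sum_Icc_gap (d : ℕ → ℝ) (m : ℕ) :
    ∑ i ∈ Finset.Icc 1 m, (d (i + 1) - d i) = d (m + 1) - d 1 := by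
  induction m with
  | zero => simp
  | succ k ih =>
    rw [Finset.sum_Icc_succ_top (by omega), ih]
    ring

/-- Abel summation; with `d = V'(s)` both boundary terms vanish by convention. -/
theorem sum_Icc_by_parts (d v : ℕ → ℝ) {m : ℕ} (hm : 1 ≤ m) :
    ∑ i ∈ Finset.Icc 2 m, d i * (v (i - 1) - v i) =
      ∑ i ∈ Finset.Icc 1 m, v i * (d (i + 1) - d i) - v m * d (m + 1) + v 1 * d 1 := by
  induction m, hm using Nat.le_induction with
  | base => simp; ring
  | succ k hk ih =>
    rw [Finset.sum_Icc_succ_top (by omega), Finset.sum_Icc_succ_top (by omega), ih]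
    simp only [Nat.add_sub_cancel]
    ring

/-! ### Coordinates -/

theorem spacing_of_mem (x : State n) {i : ℕ} (h : i ∈ Finset.Icc 2 n) :
    spacing x i = x (Sum.inl ⟨i, h⟩) := dif_pos h

theorem speed_of_mem (x : State n) {i : ℕ} (h : i ∈ Finset.Icc 1 n) :
    speed x i = x (Sum.inr ⟨i, h⟩) := dif_pos h

/-- The spacing as a continuous linear functional. -/
def spacingCLM (n i : ℕ) : State n →L[ℝ] ℝ :=
  if h : i ∈ Finset.Icc 2 n then EuclideanSpace.proj (Sum.inl ⟨i, h⟩) else 0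

/-- The speed as a continuous linear functional. -/
def speedCLM (n i : ℕ) : State n →L[ℝ] ℝ :=
  if h : i ∈ Finset.Icc 1 n then EuclideanSpace.proj (Sum.inr ⟨i, h⟩) else 0

theorem spacingCLM_apply (i : ℕ) (x : State n) : spacingCLM n i x = spacing x i := by
  unfold spacingCLM spacing
  split_ifs <;> rfl

theorem speedCLM_apply (i : ℕ) (x : State n) : speedCLM n i x = speed x i := by
  unfold speedCLM speed
  split_ifs <;> rfl

theorem contDiff_spacing (i : ℕ) {m : WithTop ℕ∞} :
    ContDiff ℝ m (fun x : State n => spacing x i) := by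
  simp only [← spacingCLM_apply]
  exact (spacingCLM n i).contDiff

theorem contDiff_speed (i : ℕ) {m : WithTop ℕ∞} :
    ContDiff ℝ m (fun x : State n => speed x i) := by
  simp only [← speedCLM_apply]
  exact (speedCLM n i).contDiff

theorem hasDerivWithinAt_spacing {x : ℝ → State n} {x' : State n} {S : Set ℝ} {t : ℝ}
    (hx : HasDerivWithinAt x x' S t) (i : ℕ) :
    HasDerivWithinAt (fun u => spacing (x u) i) (spacing x' i) S t := by
  simp only [← spacingCLM_apply]
  exact (spacingCLM n i).hasFDerivAt.comp_hasDerivWithinAt t hx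

theorem hasDerivWithinAt_speed {x : ℝ → State n} {x' : State n} {S : Set ℝ} {t : ℝ}
    (hx : HasDerivWithinAt x x' S t) (i : ℕ) :
    HasDerivWithinAt (fun u => speed (x u) i) (speed x' i) S t := by
  simp only [← speedCLM_apply]
  exact (speedCLM n i).hasFDerivAt.comp_hasDerivWithinAt t hx

namespace Controller

variable (c : Controller)

theorem isOpen_stateSpace (n : ℕ) : IsOpen (c.stateSpace n) := by
  have h : c.stateSpace n = (⋂ i ∈ Finset.Icc 2 n, {x : State n | c.L < spacing x i}) ∩
      ⋂ i ∈ Finset.Icc 1 n, {x : State n | 0 < speed x i ∧ speed x i < c.vmax} := by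
    ext x
    simp [stateSpace]
  rw [h]
  refine (isOpen_biInter_finset fun i _ => ?_).inter (isOpen_biInter_finset fun i _ => ?_)
  · exact isOpen_lt continuous_const (contDiff_spacing i (m := 0)).continuous
  · have hc := (contDiff_speed (n := n) i (m := 0)).continuous
    exact (isOpen_lt continuous_const hc).inter (isOpen_lt hc continuous_const)

theorem spacing_field (x : State n) {i : ℕ} (h : i ∈ Finset.Icc 2 n) :
    spacing (c.field x) i = speed x (i - 1) - speed x i := by
  rw [spacing_of_mem _ h]
  rfl

theorem speed_field (x : State n) {i : ℕ} (h : i ∈ Finset.Icc 1 n) :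
    speed (c.field x) i = c.accel x i := by
  rw [speed_of_mem _ h]
  rfl

theorem dV_one (x : State n) : c.dV x 1 = 0 := by simp [dV]

theorem dV_succ (x : State n) : c.dV x (n + 1) = 0 := by simp [dV]

theorem desired_pos (x : State n) (i : ℕ) : 0 < c.desired x i :=
  sub_pos.2 (c.b_mem _).2

theorem desired_lt (x : State n) (i : ℕ) : c.desired x i < c.vmax := by
  have := (c.b_mem (c.dV x (i + 1) - c.dV x i)).1
  unfold desired
  linarith

theorem vmax_pos : 0 < c.vmax := c.vstar_pos.trans c.vstar_lt_vmax

/-- The numerator is `v_max² (v (v_max - y) + y (v_max - v))`. -/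
theorem beta_pos {v y : ℝ} (hv : 0 < v) (hv' : v < c.vmax) (hy : 0 < y) (hy' : y < c.vmax) :
    0 < c.beta v y := by
  have h1 : 0 < v * (c.vmax - y) + y * (c.vmax - v) :=
    add_pos (mul_pos hv (sub_pos.2 hy')) (mul_pos hy (sub_pos.2 hv'))
  have h2 : 0 < c.vmax - v := sub_pos.2 hv'
  have h3 := c.vmax_pos
  refine div_pos ?_ (by positivity)
  nlinarith [mul_pos (pow_pos h3 2) h1]

theorem contDiffOn_dV (i : ℕ) : ContDiffOn ℝ 1 (fun x : State n => c.dV x i) (c.stateSpace n) := by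
  unfold dV
  split_ifs with h
  · exact (c.contDiffOn_deriv_V.of_le (by norm_num)).comp (contDiff_spacing i).contDiffOn
      fun x hx => hx.1 i h
  · exact contDiffOn_const

theorem contDiffOn_d2V (i : ℕ) :
    ContDiffOn ℝ 1 (fun x : State n => c.d2V x i) (c.stateSpace n) := by
  unfold d2V
  split_ifs with h
  · exact c.contDiffOn_deriv2_V.comp (contDiff_spacing i).contDiffOn fun x hx => hx.1 i h
  · exact contDiffOn_const

theorem contDiffOn_desired (i : ℕ) :
    ContDiffOn ℝ 1 (fun x : State n => c.desired x i) (c.stateSpace n) :=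
  contDiffOn_const.sub ((c.b_contDiff.of_le (by norm_num)).comp_contDiffOn
    ((c.contDiffOn_dV (i + 1)).sub (c.contDiffOn_dV i)))

theorem contDiffOn_viscous (i : ℕ) :
    ContDiffOn ℝ 1 (fun x : State n => c.viscous x i) (c.stateSpace n) := by
  have hv : ∀ j, ContDiffOn ℝ 1 (fun x : State n => speed x j) (c.stateSpace n) :=
    fun j => (contDiff_speed j).contDiffOn
  exact (contDiffOn_const.mul (c.contDiff_deriv_b.comp_contDiffOn
    ((c.contDiffOn_dV (i + 1)).sub (c.contDiffOn_dV i)))).mul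
    (((c.contDiffOn_d2V (i + 1)).mul ((hv i).sub (hv (i + 1)))).sub
      ((c.contDiffOn_d2V i).mul ((hv (i - 1)).sub (hv i))))

theorem contDiffOn_accel {i : ℕ} (hi : i ∈ Finset.Icc 1 n) :
    ContDiffOn ℝ 1 (fun x : State n => c.accel x i) (c.stateSpace n) := by
  have hv : ContDiffOn ℝ 1 (fun x : State n => speed x i) (c.stateSpace n) :=
    (contDiff_speed i).contDiffOn
  have hf := c.contDiffOn_desired (n := n) i
  have hb : ContDiffOn ℝ 1 (fun x : State n => c.beta (speed x i) (c.desired x i))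
      (c.stateSpace n) := by
    unfold beta
    refine ContDiffOn.div (by fun_prop) (by fun_prop) fun x hx => ?_
    have h1 := (hx.2 i hi).1
    have h2 := sub_pos.2 (hx.2 i hi).2
    positivity
  have hZ := c.contDiffOn_viscous (n := n) i
  have hd := c.contDiffOn_dV (n := n) i
  have hd' := c.contDiffOn_dV (n := n) (i + 1)
  unfold accel
  refine (contDiffOn_const.div hb fun x hx => ?_).mul
    (((ContDiffOn.div (by fun_prop) (by fun_prop) fun x hx => ?_).add hd).sub hd')
  · exact (c.beta_pos (hx.2 i hi).1 (hx.2 i hi).2 (c.desired_pos x i) (c.desired_lt x i)).ne'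
  · exact (mul_pos (hx.2 i hi).1 (sub_pos.2 (hx.2 i hi).2)).ne'

theorem contDiffOn_field (n : ℕ) : ContDiffOn ℝ 1 (c.field (n := n)) (c.stateSpace n) := by
  rw [contDiffOn_euclidean]
  rintro (i | i)
  · exact ((contDiff_speed ((i : ℕ) - 1)).sub (contDiff_speed (i : ℕ))).contDiffOn
  · exact c.contDiffOn_accel i.2

end Controller

namespace Controller

variable (c : Controller)

/-! ### The Lyapunov function along solutions -/

/-- The argument `V'(sᵢ₊₁) - V'(sᵢ)` of `b` in the desired speed. -/
def gap (x : State n) (i : ℕ) : ℝ := c.dV x (i + 1) - c.dV x i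

/-- The rate of decrease of the Lyapunov function along solutions. -/
def dissipation (x : State n) : ℝ :=
  c.μ * c.vmax ^ 2 * ∑ i ∈ Finset.Icc 1 n,
      (speed x i - c.desired x i) ^ 2 / (speed x i * (c.vmax - speed x i)) +
    ∑ i ∈ Finset.Icc 1 n, c.gap x i * c.b (c.gap x i)

theorem speed_mul_pos {x : State n} (hx : x ∈ c.stateSpace n) {i : ℕ} (hi : i ∈ Finset.Icc 1 n) :
    0 < speed x i * (c.vmax - speed x i) :=
  mul_pos (hx.2 i hi).1 (sub_pos.2 (hx.2 i hi).2)

theorem kinetic_nonneg {x : State n} (hx : x ∈ c.stateSpace n) {i : ℕ}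
    (hi : i ∈ Finset.Icc 1 n) :
    0 ≤ (speed x i - c.desired x i) ^ 2 / (speed x i * (c.vmax - speed x i)) :=
  div_nonneg (sq_nonneg _) (c.speed_mul_pos hx hi).le

/-- An identity at a single state, not along a solution, so it also serves to find the equilibria.
The cross term `(vᵢ - fᵢ) gᵢ` cancels against the potential's `vᵢ gᵢ`, leaving `fᵢ gᵢ = v* gᵢ - gᵢ
b(gᵢ)`. -/
theorem energy_balance (hn : 1 ≤ n) {x : State n} (hx : x ∈ c.stateSpace n) :
    ∑ i ∈ Finset.Icc 1 n, (speed x i - c.desired x i) *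
        (c.beta (speed x i) (c.desired x i) * c.accel x i -
          c.viscous x i / (speed x i * (c.vmax - speed x i))) +
      ∑ i ∈ Finset.Icc 2 n, c.dV x i * (speed x (i - 1) - speed x i) = -c.dissipation x := by
  have hsum : ∑ i ∈ Finset.Icc 1 n, c.gap x i = 0 := by
    have := sum_Icc_gap (c.dV x) n
    rw [c.dV_one, c.dV_succ, sub_zero] at this
    exact this
  have hterm : ∀ i ∈ Finset.Icc 1 n, (speed x i - c.desired x i) *
        (c.beta (speed x i) (c.desired x i) * c.accel x i -
          c.viscous x i / (speed x i * (c.vmax - speed x i))) +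
        speed x i * (c.dV x (i + 1) - c.dV x i) =
      c.vstar * c.gap x i - (c.μ * c.vmax ^ 2 *
        ((speed x i - c.desired x i) ^ 2 / (speed x i * (c.vmax - speed x i))) +
        c.gap x i * c.b (c.gap x i)) := by
    intro i hi
    have hβ := (c.beta_pos (hx.2 i hi).1 (hx.2 i hi).2 (c.desired_pos x i) (c.desired_lt x i)).ne'
    have hacc : c.beta (speed x i) (c.desired x i) * c.accel x i =
        (c.viscous x i - c.μ * c.vmax ^ 2 * (speed x i - c.desired x i)) /
          (speed x i * (c.vmax - speed x i)) - c.gap x i := by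
      rw [accel, gap, one_div, mul_inv_cancel_left₀ hβ]
      ring
    have hdes : c.desired x i = c.vstar - c.b (c.gap x i) := rfl
    have hgap : c.dV x (i + 1) - c.dV x i = c.gap x i := rfl
    rw [hacc, hgap]
    have : speed x i * c.gap x i = (speed x i - c.desired x i) * c.gap x i +
        (c.vstar - c.b (c.gap x i)) * c.gap x i := by
      rw [← hdes]
      ring
    rw [this]
    ring
  rw [sum_Icc_by_parts (c.dV x) (speed x) hn, c.dV_one, c.dV_succ, mul_zero, mul_zero, sub_zero,
    add_zero, ← Finset.sum_add_distrib, Finset.sum_congr rfl hterm, Finset.sum_sub_distrib,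
    ← Finset.mul_sum, hsum, Finset.sum_add_distrib, ← Finset.mul_sum, dissipation]
  ring

variable {c}

theorem hasDerivWithinAt_dV {x : ℝ → State n} {S : Set ℝ} {t : ℝ} (hxt : x t ∈ c.stateSpace n)
    (hx : HasDerivWithinAt x (c.field (x t)) S t) (i : ℕ) :
    HasDerivWithinAt (fun u => c.dV (x u) i)
      (c.d2V (x t) i * (speed (x t) (i - 1) - speed (x t) i)) S t := by
  unfold dV d2V
  split_ifs with h
  · rw [← c.spacing_field (x t) h]
    exact (c.hasDerivAt_deriv_V (hxt.1 i h)).comp_hasDerivWithinAt t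
      (hasDerivWithinAt_spacing hx i)
  · rw [zero_mul]
    exact hasDerivWithinAt_const _ _ _

theorem hasDerivWithinAt_desired {x : ℝ → State n} {S : Set ℝ} {t : ℝ}
    (hxt : x t ∈ c.stateSpace n) (hx : HasDerivWithinAt x (c.field (x t)) S t) (i : ℕ) :
    HasDerivWithinAt (fun u => c.desired (x u) i) (c.viscous (x t) i / c.vmax ^ 2) S t := by
  have h := ((c.hasDerivAt_b _).comp_hasDerivWithinAt t ((hasDerivWithinAt_dV hxt hx (i + 1)).sub
    (hasDerivWithinAt_dV hxt hx i))).const_sub c.vstar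
  refine h.congr_deriv ?_
  have := c.vmax_pos.ne'
  rw [viscous, Nat.add_sub_cancel]
  field_simp
  simp only [Pi.sub_apply]
  ring

theorem hasDerivWithinAt_lyap (hn : 1 ≤ n) {x : ℝ → State n} {S : Set ℝ} {t : ℝ}
    (hxt : x t ∈ c.stateSpace n) (hx : HasDerivWithinAt x (c.field (x t)) S t) :
    HasDerivWithinAt (fun u => c.lyap (x u)) (-c.dissipation (x t)) S t := by
  have hkin : ∀ i ∈ Finset.Icc 1 n, HasDerivWithinAt
      (fun u => (speed (x u) i - c.desired (x u) i) ^ 2 / (speed (x u) i * (c.vmax - speed (x u) i)))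
      (2 / c.vmax ^ 2 * ((speed (x t) i - c.desired (x t) i) *
        (c.beta (speed (x t) i) (c.desired (x t) i) * c.accel (x t) i -
          c.viscous (x t) i / (speed (x t) i * (c.vmax - speed (x t) i))))) S t := by
    intro i hi
    have hv := hasDerivWithinAt_speed hx i
    rw [c.speed_field (x t) hi] at hv
    have hv0 := (hxt.2 i hi).1.ne'
    have hv1 := (sub_pos.2 (hxt.2 i hi).2).ne'
    have hm := c.vmax_pos.ne'
    have h := ((hv.sub (hasDerivWithinAt_desired hxt hx i)).pow 2).div
      (hv.mul (hv.const_sub c.vmax)) (mul_ne_zero hv0 hv1)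
    refine h.congr_deriv ?_
    simp only [beta, Pi.sub_apply, Pi.mul_apply, Pi.pow_apply]
    field_simp
    ring
  have hpot : ∀ i ∈ Finset.Icc 2 n, HasDerivWithinAt (fun u => c.V (spacing (x u) i))
      (c.dV (x t) i * (speed (x t) (i - 1) - speed (x t) i)) S t := by
    intro i hi
    rw [dV, if_pos hi, ← c.spacing_field (x t) hi]
    exact (c.hasDerivAt_V (hxt.1 i hi)).comp_hasDerivWithinAt t (hasDerivWithinAt_spacing hx i)
  have h := ((HasDerivWithinAt.fun_sum hkin).const_mul (c.vmax ^ 2 / 2)).add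
    (HasDerivWithinAt.fun_sum hpot)
  refine h.congr_deriv ?_
  rw [← c.energy_balance hn hxt, ← Finset.mul_sum, ← mul_assoc]
  have hm := c.vmax_pos.ne'
  congr 1
  field_simp

variable (c)

/-! ### Dissipation dominates a function of the Lyapunov function -/

theorem lyap_nonneg {x : State n} (hx : x ∈ c.stateSpace n) : 0 ≤ c.lyap x := by
  have h1 := Finset.sum_nonneg fun i hi => c.kinetic_nonneg hx (i := i) hi
  have h2 : 0 ≤ ∑ i ∈ Finset.Icc 2 n, c.V (spacing x i) :=
    Finset.sum_nonneg fun i hi => c.V_nonneg _ (hx.1 i hi)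
  exact add_nonneg (mul_nonneg (by positivity) h1) h2

theorem V_le_lyap {x : State n} (hx : x ∈ c.stateSpace n) {i : ℕ} (hi : i ∈ Finset.Icc 2 n) :
    c.V (spacing x i) ≤ c.lyap x := by
  have h1 := Finset.sum_nonneg fun i hi => c.kinetic_nonneg hx (i := i) hi
  have h2 := Finset.single_le_sum (f := fun i => c.V (spacing x i))
    (fun i hi => c.V_nonneg _ (hx.1 i hi)) hi
  have h3 := mul_nonneg (by positivity : 0 ≤ c.vmax ^ 2 / 2) h1
  unfold lyap
  linarith

theorem sq_le_lyap {x : State n} (hx : x ∈ c.stateSpace n) {i : ℕ} (hi : i ∈ Finset.Icc 1 n) :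
    c.vmax ^ 2 / 2 * (speed x i - c.desired x i) ^ 2 ≤
      c.lyap x * (speed x i * (c.vmax - speed x i)) := by
  rw [← div_le_iff₀ (c.speed_mul_pos hx hi), mul_div_assoc]
  have h1 := Finset.single_le_sum
    (f := fun i => (speed x i - c.desired x i) ^ 2 / (speed x i * (c.vmax - speed x i)))
    (fun i hi => c.kinetic_nonneg hx hi) hi
  have h2 : 0 ≤ ∑ i ∈ Finset.Icc 2 n, c.V (spacing x i) :=
    Finset.sum_nonneg fun i hi => c.V_nonneg _ (hx.1 i hi)
  have h3 := mul_le_mul_of_nonneg_left h1 (by positivity : 0 ≤ c.vmax ^ 2 / 2)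
  unfold lyap
  linarith

/-- Telescope from `V'(s₁) = 0` up to `V'(sⱼ)`. -/
theorem abs_dV_le {x : State n} {r : ℝ} (hr : ∀ i ∈ Finset.Icc 1 n, |c.gap x i| ≤ r) {j : ℕ}
    (hj : j ∈ Finset.Icc 2 n) : |c.dV x j| ≤ n * r := by
  obtain ⟨h2, hjn⟩ := Finset.mem_Icc.1 hj
  have hr0 : 0 ≤ r := (abs_nonneg _).trans (hr 1 (Finset.mem_Icc.2 ⟨le_rfl, by omega⟩))
  have hsum := sum_Icc_gap (c.dV x) (j - 1)
  rw [c.dV_one, sub_zero, Nat.sub_add_cancel (by omega)] at hsum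
  rw [← hsum]
  refine (Finset.abs_sum_le_sum_abs _ _).trans ((Finset.sum_le_card_nsmul _ _ r fun i hi => ?_).trans ?_)
  · rw [Finset.mem_Icc] at hi
    exact hr i (Finset.mem_Icc.2 ⟨hi.1, by omega⟩)
  · rw [nsmul_eq_mul, Nat.card_Icc]
    refine mul_le_mul_of_nonneg_right ?_ hr0
    exact_mod_cast (by omega : j - 1 + 1 - 1 ≤ n)

/-- A lower bound for the dissipation in terms of the Lyapunov function. -/
def decayRate (n : ℕ) (h : ℝ) : ℝ :=
  min (c.μ * h) (c.bGain (h / (4 * n ^ 2 * (c.lam - c.L))))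

theorem continuous_decayRate (n : ℕ) : Continuous (c.decayRate n) := by
  have := c.continuous_bGain
  unfold decayRate
  fun_prop

theorem decayRate_zero (n : ℕ) : c.decayRate n 0 = 0 := by
  simp [decayRate, c.bGain_zero]

theorem decayRate_pos (hn : 1 ≤ n) {h : ℝ} (hh : 0 < h) : 0 < c.decayRate n h := by
  have h1 : (0 : ℝ) < n := by exact_mod_cast hn
  have h2 : 0 < c.lam - c.L := sub_pos.2 c.L_lt_lam
  exact lt_min (mul_pos c.μ_pos hh) (c.bGain_pos (by positivity))

theorem monotoneOn_decayRate (n : ℕ) : MonotoneOn (c.decayRate n) (Ici 0) := by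
  intro p hp q hq hpq
  have h2 : 0 < c.lam - c.L := sub_pos.2 c.L_lt_lam
  have hp' : (0 : ℝ) ≤ p := hp
  have hq' : (0 : ℝ) ≤ q := hq
  refine min_le_min (mul_le_mul_of_nonneg_left hpq c.μ_pos.le) (c.monotoneOn_bGain ?_ ?_ ?_)
  · exact div_nonneg hp' (by positivity)
  · exact div_nonneg hq' (by positivity)
  · gcongr

theorem decayRate_le_dissipation (hn : 1 ≤ n) {x : State n} (hx : x ∈ c.stateSpace n) :
    c.decayRate n (c.lyap x) ≤ c.dissipation x := by
  have hn0 : (0 : ℝ) < n := by exact_mod_cast hn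
  have hl : 0 < c.lam - c.L := sub_pos.2 c.L_lt_lam
  have hk := Finset.sum_nonneg fun i hi => c.kinetic_nonneg hx (i := i) hi
  have hg : 0 ≤ ∑ i ∈ Finset.Icc 1 n, c.gap x i * c.b (c.gap x i) :=
    Finset.sum_nonneg fun i _ => c.b_mul_self_nonneg _
  have hμ := c.μ_pos
  have hkμ := mul_nonneg (by positivity : 0 ≤ c.μ * c.vmax ^ 2) hk
  rcases (c.lyap_nonneg hx).eq_or_lt with h0 | hpos
  · rw [← h0, c.decayRate_zero]
    exact add_nonneg hkμ hg
  -- If the kinetic part carries half of `H`, friction alone dissipates `μ H`. Otherwise some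
  -- `V(sⱼ)` exceeds `H / (2n)`; were all gaps at most `H / (4n² (λ - L))`, then `V(sⱼ) ≤ |V'(sⱼ)|
  -- (λ - L) ≤ H / (4n)`, a contradiction.
  by_cases hcase : c.lyap x / 2 ≤ c.vmax ^ 2 / 2 * ∑ i ∈ Finset.Icc 1 n,
      (speed x i - c.desired x i) ^ 2 / (speed x i * (c.vmax - speed x i))
  · refine (min_le_left _ _).trans ?_
    unfold dissipation
    nlinarith
  · have hV : c.lyap x / 2 < ∑ i ∈ Finset.Icc 2 n, c.V (spacing x i) := by
      have : c.lyap x = c.vmax ^ 2 / 2 * ∑ i ∈ Finset.Icc 1 n,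
        (speed x i - c.desired x i) ^ 2 / (speed x i * (c.vmax - speed x i)) +
        ∑ i ∈ Finset.Icc 2 n, c.V (spacing x i) := rfl
      linarith
    obtain ⟨j, hj, hVj⟩ : ∃ j ∈ Finset.Icc 2 n, c.lyap x / (2 * n) < c.V (spacing x j) := by
      by_contra! hle
      have h1 := Finset.sum_le_card_nsmul _ _ _ hle
      rw [nsmul_eq_mul, Nat.card_Icc] at h1
      have h2 : ((n + 1 - 2 : ℕ) : ℝ) ≤ n := by exact_mod_cast (by omega : n + 1 - 2 ≤ n)
      have h3 := mul_le_mul_of_nonneg_right h2 (by positivity : 0 ≤ c.lyap x / (2 * n))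
      have h4 : n * (c.lyap x / (2 * n)) = c.lyap x / 2 := by field_simp
      linarith
    obtain ⟨i, hi, hgi⟩ : ∃ i ∈ Finset.Icc 1 n,
        c.lyap x / (4 * n ^ 2 * (c.lam - c.L)) < |c.gap x i| := by
      by_contra! hle
      have h1 := c.abs_dV_le hle hj
      rw [dV, if_pos hj] at h1
      have h2 := c.V_le_neg_deriv_mul (hx.1 j hj)
      have h3 := mul_le_mul_of_nonneg_right ((neg_le_abs _).trans h1) hl.le
      have h4 : n * (c.lyap x / (4 * n ^ 2 * (c.lam - c.L))) * (c.lam - c.L) =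
          c.lyap x / (2 * n) / 2 := by
        field_simp
        norm_num
      have h5 : 0 < c.lyap x / (2 * n) := by positivity
      linarith
    refine (min_le_right _ _).trans ((c.bGain_le (by positivity) hgi.le).trans ?_)
    have h1 := Finset.single_le_sum (f := fun i => c.gap x i * c.b (c.gap x i))
      (fun i _ => c.b_mul_self_nonneg _) hi
    unfold dissipation
    linarith

variable {c}

/-- The Lyapunov estimate along solutions. -/
theorem lyap_add_mul_le (hn : 1 ≤ n) {T : EReal} {x : ℝ → State n}
    (hx : IsSolution (c.stateSpace n) c.field T x) {t : ℝ} (ht : t ∈ timeInterval T) :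
    c.lyap (x t) + t * c.decayRate n (c.lyap (x t)) ≤ c.lyap (x 0) := by
  have hsub := Icc_subset_timeInterval ht
  have hd : ∀ s ∈ Icc 0 t, HasDerivWithinAt (fun u => c.lyap (x u)) (-c.dissipation (x s))
      (Icc 0 t) s := fun s hs => by
    obtain ⟨h1, h2⟩ := hx.2 s (hsub hs)
    exact hasDerivWithinAt_lyap hn h1 (h2.mono hsub)
  have hrate : ∀ s ∈ Icc 0 t, 0 ≤ c.lyap (x s) ∧
      c.decayRate n (c.lyap (x s)) ≤ c.dissipation (x s) := fun s hs =>
    ⟨c.lyap_nonneg (hx.2 s (hsub hs)).1, c.decayRate_le_dissipation hn (hx.2 s (hsub hs)).1⟩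
  have hanti : AntitoneOn (fun u => c.lyap (x u)) (Icc 0 t) := by
    refine antitoneOn_of_hasDerivWithinAt_nonpos (convex_Icc 0 t)
      (fun s hs => (hd s hs).continuousWithinAt)
      (fun s hs => (hd s (interior_subset hs)).mono interior_subset) fun s hs => ?_
    obtain ⟨h1, h2⟩ := hrate s (interior_subset hs)
    have h3 := c.monotoneOn_decayRate n (self_mem_Ici (a := (0 : ℝ))) h1 h1
    rw [c.decayRate_zero] at h3
    linarith
  have ht0 : t ∈ Icc 0 t := ⟨ht.1, le_rfl⟩
  -- The rate is frozen at its value at time `t`: for `s ≤ t`, `H(s) ≥ H(t)`, so the dissipation at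
  -- `s` is at least `α(H(t))`.
  have hanti' : AntitoneOn (fun u => c.lyap (x u) + u * c.decayRate n (c.lyap (x t)))
      (Icc 0 t) := by
    have hd' : ∀ s ∈ Icc 0 t,
        HasDerivWithinAt (fun u => c.lyap (x u) + u * c.decayRate n (c.lyap (x t)))
          (-c.dissipation (x s) + 1 * c.decayRate n (c.lyap (x t))) (Icc 0 t) s := fun s hs =>
      (hd s hs).add ((hasDerivWithinAt_id s _).mul_const _)
    refine antitoneOn_of_hasDerivWithinAt_nonpos (convex_Icc 0 t)
      (fun s hs => (hd' s hs).continuousWithinAt)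
      (fun s hs => (hd' s (interior_subset hs)).mono interior_subset) fun s hs => ?_
    obtain ⟨h1, h2⟩ := hrate s (interior_subset hs)
    have h3 := c.monotoneOn_decayRate n (hrate t ht0).1 h1
      (hanti (interior_subset hs) ht0 (interior_subset hs).2)
    linarith
  have := hanti' (show (0 : ℝ) ∈ Icc 0 t from ⟨le_rfl, ht.1⟩) ht0 ht.1
  simpa using this

end Controller

namespace Controller

variable (c : Controller)

/-! ### Global existence -/

/-- The part of a sublevel set of the Lyapunov function in a ball lies in a compact subset of the
state space. -/
theorem exists_isCompact_sublevel (n : ℕ) (h R : ℝ) :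
    ∃ K ⊆ c.stateSpace n, IsCompact K ∧
      ∀ x ∈ c.stateSpace n, c.lyap x ≤ h → ‖x‖ ≤ R → x ∈ K := by
  obtain ⟨l, hl, hVl⟩ := c.exists_forall_le_of_V_le h
  set G : ℝ := -deriv c.V l with hG
  have hG0 : 0 ≤ G := neg_nonneg.2 (c.deriv_V_nonpos hl)
  -- Spacings at least `l` confine the gaps to `[-G, G]`, hence `fᵢ` to `[p, v_max - q]`.
  set p : ℝ := c.vstar - c.b G with hp
  set q : ℝ := c.vmax - c.vstar + c.b (-G) with hq
  have hp0 : 0 < p := sub_pos.2 (c.b_mem G).2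
  have hq0 : 0 < q := by
    have := (c.b_mem (-G)).1
    rw [hq]
    linarith
  have hm := c.vmax_pos
  set C : ℝ := |h| + 1 with hC
  have hC0 : 0 < C := by positivity
  -- If `v < p/2` then `|v - f| ≥ p/2`, and the energy bound gives `v_max² p² / 8 ≤ C v v_max`, that
  -- is `v ≥ v_max p² / (8C)`. The same argument near `v_max` gives `e₂`.
  set e₁ : ℝ := min (p / 2) (c.vmax * p ^ 2 / (8 * C)) with he₁
  set e₂ : ℝ := min (q / 2) (c.vmax * q ^ 2 / (8 * C)) with he₂
  have he₁0 : 0 < e₁ := lt_min (by positivity) (by positivity)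
  have he₂0 : 0 < e₂ := lt_min (by positivity) (by positivity)
  let A : Set (State n) := {x | (∀ i ∈ Finset.Icc 2 n, l ≤ spacing x i) ∧
    ∀ i ∈ Finset.Icc 1 n, e₁ ≤ speed x i ∧ speed x i ≤ c.vmax - e₂}
  have hA : IsClosed A := by
    have hAeq : A = (⋂ i ∈ Finset.Icc 2 n, {x : State n | l ≤ spacing x i}) ∩
        ⋂ i ∈ Finset.Icc 1 n, {x : State n | e₁ ≤ speed x i ∧ speed x i ≤ c.vmax - e₂} := by
      ext x
      simp [A]
    rw [hAeq]
    refine (isClosed_biInter fun i _ => ?_).inter (isClosed_biInter fun i _ => ?_)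
    · exact isClosed_le continuous_const (contDiff_spacing i (m := 0)).continuous
    · have hc := (contDiff_speed (n := n) i (m := 0)).continuous
      exact (isClosed_le continuous_const hc).inter (isClosed_le hc continuous_const)
  refine ⟨A ∩ Metric.closedBall 0 R, ?_, (isCompact_closedBall 0 R).inter_left hA, ?_⟩
  · rintro x ⟨⟨h1, h2⟩, -⟩
    exact ⟨fun i hi => lt_of_lt_of_le hl (h1 i hi), fun i hi =>
      ⟨he₁0.trans_le (h2 i hi).1, (h2 i hi).2.trans_lt (by linarith)⟩⟩
  · intro x hx hlx hR
    have hs : ∀ i ∈ Finset.Icc 2 n, l ≤ spacing x i := fun i hi =>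
      hVl _ (hx.1 i hi) ((c.V_le_lyap hx hi).trans hlx)
    refine ⟨⟨hs, fun i hi => ?_⟩, by simpa using hR⟩
    have hdV : ∀ j, -G ≤ c.dV x j ∧ c.dV x j ≤ 0 := fun j => by
      unfold dV
      split_ifs with hj
      · have := c.monotoneOn_deriv_V hl (hx.1 j hj) (hs j hj)
        exact ⟨by linarith, c.deriv_V_nonpos (hx.1 j hj)⟩
      · exact ⟨by linarith, le_rfl⟩
    have hb := c.b_strictMono.monotone
    have hf₁ : p ≤ c.desired x i := by
      have := hb (show c.dV x (i + 1) - c.dV x i ≤ G by linarith [(hdV (i + 1)).2, (hdV i).1])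
      unfold desired
      linarith
    have hf₂ : q ≤ c.vmax - c.desired x i := by
      have := hb (show -G ≤ c.dV x (i + 1) - c.dV x i by linarith [(hdV (i + 1)).1, (hdV i).2])
      unfold desired
      linarith
    obtain ⟨hv0, hv1⟩ := hx.2 i hi
    set v := speed x i
    set f := c.desired x i
    have hsq : c.vmax ^ 2 / 2 * (v - f) ^ 2 ≤ C * (v * (c.vmax - v)) :=
      (c.sq_le_lyap hx hi).trans (mul_le_mul_of_nonneg_right
        (by have := le_abs_self h; linarith) (c.speed_mul_pos hx hi).le)
    constructor
    · by_contra! hlt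
      obtain ⟨ha, hb'⟩ := lt_min_iff.1 hlt
      rw [lt_div_iff₀ (by positivity)] at hb'
      have h1 : (p / 2) ^ 2 ≤ (v - f) ^ 2 := by nlinarith
      have h2 : C * (v * (c.vmax - v)) ≤ C * (v * c.vmax) := by
        gcongr
        linarith
      have h3 := mul_le_mul_of_nonneg_left h1 (by positivity : 0 ≤ c.vmax ^ 2 / 2)
      have h4 := mul_lt_mul_of_pos_left hb' hm
      nlinarith
    · by_contra! hlt
      obtain ⟨ha, hb'⟩ := lt_min_iff.1 (show c.vmax - v < e₂ by linarith)
      rw [lt_div_iff₀ (by positivity)] at hb'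
      have h1 : (q / 2) ^ 2 ≤ (v - f) ^ 2 := by nlinarith
      have h2 : C * (v * (c.vmax - v)) ≤ C * (c.vmax * (c.vmax - v)) :=
        mul_le_mul_of_nonneg_left (mul_le_mul_of_nonneg_right hv1.le (by linarith)) hC0.le
      have h3 := mul_le_mul_of_nonneg_left h1 (by positivity : 0 ≤ c.vmax ^ 2 / 2)
      have h4 := mul_lt_mul_of_pos_left hb' hm
      nlinarith

/-- With `N` coordinates, `N r² ≤ ((N + 1) r)²`; the crude constant avoids a square root. -/
theorem norm_le_of_coord_le {x : State n} {r : ℝ} (hr : 0 ≤ r)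
    (h₁ : ∀ i ∈ Finset.Icc 2 n, |spacing x i| ≤ r) (h₂ : ∀ i ∈ Finset.Icc 1 n, |speed x i| ≤ r) :
    ‖x‖ ≤ (Fintype.card (Finset.Icc 2 n ⊕ Finset.Icc 1 n) + 1) * r := by
  have hcoord : ∀ j, ‖x j‖ ^ 2 ≤ r ^ 2 := by
    intro j
    rw [Real.norm_eq_abs]
    refine pow_le_pow_left₀ (abs_nonneg _) ?_ 2
    rcases j with j | j
    · have := h₁ j j.2
      rwa [spacing_of_mem x j.2] at this
    · have := h₂ j j.2
      rwa [speed_of_mem x j.2] at this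
  rw [EuclideanSpace.norm_eq]
  refine Real.sqrt_le_iff.2 ⟨by positivity, (Finset.sum_le_card_nsmul _ _ _ fun j _ => hcoord j).trans ?_⟩
  rw [nsmul_eq_mul, Finset.card_univ, mul_pow]
  refine mul_le_mul_of_nonneg_right ?_ (sq_nonneg r)
  have : (0 : ℝ) ≤ Fintype.card (Finset.Icc 2 n ⊕ Finset.Icc 1 n) := Nat.cast_nonneg _
  nlinarith

/-- In finite time, a solution stays in a bounded set. -/
theorem exists_norm_le {T : EReal} {x : ℝ → State n}
    (hx : IsSolution (c.stateSpace n) c.field T x) (S : ℝ) :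
    ∃ R, ∀ t ∈ timeInterval T, t ≤ S → ‖x t‖ ≤ R := by
  have hm := c.vmax_pos
  -- Speeds lie in `(0, v_max)`, so each spacing changes at rate at most `v_max`; the last summand
  -- covers the speeds themselves.
  refine ⟨_, fun t ht htS => norm_le_of_coord_le (r := ‖x 0‖ + |S| * c.vmax + c.vmax)
    (by positivity) (fun i hi => ?_) (fun i hi => ?_)⟩
  · have hsub := Icc_subset_timeInterval ht
    have hd : ∀ s ∈ Icc 0 t, HasDerivWithinAt (fun u => spacing (x u) i)
        (speed (x s) (i - 1) - speed (x s) i) (Icc 0 t) s := fun s hs => by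
      rw [← c.spacing_field (x s) hi]
      exact hasDerivWithinAt_spacing ((hx.2 s (hsub hs)).2.mono hsub) i
    obtain ⟨h2, hin⟩ := Finset.mem_Icc.1 hi
    have hbd : ∀ s ∈ Icc 0 t, ‖speed (x s) (i - 1) - speed (x s) i‖ ≤ c.vmax := fun s hs => by
      have h3 := (hx.2 s (hsub hs)).1.2 (i - 1) (Finset.mem_Icc.2 ⟨by omega, by omega⟩)
      have h4 := (hx.2 s (hsub hs)).1.2 i (Finset.mem_Icc.2 ⟨by omega, by omega⟩)
      rw [Real.norm_eq_abs, abs_le]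
      constructor <;> linarith
    have := (convex_Icc 0 t).norm_image_sub_le_of_norm_hasDerivWithin_le hd hbd
      (show (0 : ℝ) ∈ Icc 0 t from ⟨le_rfl, ht.1⟩) (show t ∈ Icc 0 t from ⟨ht.1, le_rfl⟩)
    rw [sub_zero, Real.norm_eq_abs, Real.norm_of_nonneg ht.1] at this
    have h5 : |spacing (x 0) i| ≤ ‖x 0‖ := by
      rw [spacing_of_mem _ hi]
      exact PiLp.norm_apply_le (x 0) _
    have h6 := abs_sub_abs_le_abs_sub (spacing (x t) i) (spacing (x 0) i)
    have h7 := mul_le_mul_of_nonneg_right (htS.trans (le_abs_self S)) hm.le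
    linarith
  · obtain ⟨h3, h4⟩ := (hx.2 t ht).1.2 i hi
    rw [abs_of_pos h3]
    have : 0 ≤ ‖x 0‖ + |S| * c.vmax := by positivity
    linarith

theorem eq_top_of_isMaximalSolution (hn : 1 ≤ n) {T : EReal} {x : ℝ → State n}
    (hx : IsMaximalSolution (c.stateSpace n) c.field T x) : T = ⊤ := by
  refine hx.eq_top (c.isOpen_stateSpace n) (c.contDiffOn_field n) fun S => ?_
  obtain ⟨R, hR⟩ := c.exists_norm_le hx.1 S
  obtain ⟨K, hKD, hK, hxK⟩ := c.exists_isCompact_sublevel n (c.lyap (x 0)) R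
  refine ⟨K, hKD, hK, fun t ht htS => hxK _ (hx.1.2 t ht).1 ?_ (hR t ht htS)⟩
  have h1 := lyap_add_mul_le hn hx.1 ht
  have h2 := c.lyap_nonneg (hx.1.2 t ht).1
  have h3 := c.monotoneOn_decayRate n (self_mem_Ici (a := (0 : ℝ))) h2 h2
  rw [c.decayRate_zero] at h3
  have h4 := mul_nonneg ht.1 h3
  linarith

/-! ### Equilibria and the distance to them -/

theorem dV_eq_zero_of_mem_eqSet {x : State n} (hx : x ∈ c.eqSet n) (i : ℕ) : c.dV x i = 0 := by
  unfold dV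
  split_ifs with h
  · exact c.deriv_V_eq_zero (hx.1 i h)
  · rfl

theorem eqSet_subset_stateSpace (n : ℕ) : c.eqSet n ⊆ c.stateSpace n := fun x hx =>
  ⟨fun i hi => c.L_lt_lam.trans_le (hx.1 i hi), fun i hi => by
    rw [hx.2 i hi]
    exact ⟨c.vstar_pos, c.vstar_lt_vmax⟩⟩

/-- The dummy speeds `v₀` and `vₙ₊₁` are harmless because their coefficients `V''(s₁)`, `V''(sₙ₊₁)`
are `0`. -/
theorem viscous_eq_zero {x : State n} (hv : ∀ i ∈ Finset.Icc 2 n, speed x (i - 1) = speed x i)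
    (i : ℕ) : c.viscous x i = 0 := by
  have h : ∀ j, c.d2V x j * (speed x (j - 1) - speed x j) = 0 := fun j => by
    unfold d2V
    split_ifs with hj
    · rw [hv j hj, sub_self, mul_zero]
    · rw [zero_mul]
  have h1 := h (i + 1)
  rw [Nat.add_sub_cancel] at h1
  rw [viscous, h1, h i, sub_zero, mul_zero]

theorem field_eq_zero_iff {x : State n} : c.field x = 0 ↔
    (∀ i ∈ Finset.Icc 2 n, speed x (i - 1) = speed x i) ∧
      ∀ i ∈ Finset.Icc 1 n, c.accel x i = 0 := by
  constructor
  · intro h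
    refine ⟨fun i hi => ?_, fun i hi => ?_⟩
    · have := c.spacing_field x hi
      rw [h, spacing_of_mem _ hi] at this
      exact (sub_eq_zero.1 this.symm)
    · have := c.speed_field x hi
      rw [h, speed_of_mem _ hi] at this
      exact this.symm
  · rintro ⟨h1, h2⟩
    ext j
    rcases j with j | j
    · exact sub_eq_zero.2 (h1 j j.2)
    · exact h2 j j.2

theorem field_eq_zero_of_mem_eqSet {x : State n} (hx : x ∈ c.eqSet n) : c.field x = 0 := by
  have hv : ∀ i ∈ Finset.Icc 2 n, speed x (i - 1) = speed x i := fun i hi => by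
    obtain ⟨h2, hin⟩ := Finset.mem_Icc.1 hi
    rw [hx.2 (i - 1) (Finset.mem_Icc.2 ⟨by omega, by omega⟩),
      hx.2 i (Finset.mem_Icc.2 ⟨by omega, by omega⟩)]
  refine c.field_eq_zero_iff.2 ⟨hv, fun i hi => ?_⟩
  have hf : c.desired x i = c.vstar := by
    rw [desired, c.dV_eq_zero_of_mem_eqSet hx, c.dV_eq_zero_of_mem_eqSet hx, sub_zero, c.b_zero,
      sub_zero]
  rw [accel, c.viscous_eq_zero hv, hf, hx.2 i hi, c.dV_eq_zero_of_mem_eqSet hx,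
    c.dV_eq_zero_of_mem_eqSet hx]
  simp

theorem mem_eqSet_of_lyap_eq_zero {x : State n} (hx : x ∈ c.stateSpace n) (h : c.lyap x = 0) :
    x ∈ c.eqSet n := by
  have hs : ∀ i ∈ Finset.Icc 2 n, c.lam ≤ spacing x i := fun i hi => by
    by_contra! hlt
    have := c.V_pos (hx.1 i hi) hlt
    have := c.V_le_lyap hx hi
    linarith
  have hdV : ∀ j, c.dV x j = 0 := fun j => by
    unfold dV
    split_ifs with hj
    · exact c.deriv_V_eq_zero (hs j hj)
    · rfl
  refine ⟨hs, fun i hi => ?_⟩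
  have h1 := c.sq_le_lyap hx hi
  rw [h, zero_mul] at h1
  have h2 : (speed x i - c.desired x i) ^ 2 = 0 := by
    have := c.vmax_pos
    exact le_antisymm (nonpos_of_mul_nonpos_right h1 (by positivity)) (sq_nonneg _)
  have h3 := sub_eq_zero.1 (pow_eq_zero_iff two_ne_zero |>.1 h2)
  rw [h3, desired, hdV, hdV, sub_zero, c.b_zero, sub_zero]

/-- At an equilibrium both sums in the energy balance vanish, so the dissipation is `0`; as it
dominates `decayRate`, `H = 0`. No equilibrium equation has to be solved. -/
theorem eqSet_eq (hn : 1 ≤ n) : c.eqSet n = {x ∈ c.stateSpace n | c.field x = 0} := by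
  ext x
  refine ⟨fun hx => ⟨c.eqSet_subset_stateSpace n hx, c.field_eq_zero_of_mem_eqSet hx⟩, ?_⟩
  rintro ⟨hx, h0⟩
  obtain ⟨hv, ha⟩ := c.field_eq_zero_iff.1 h0
  refine c.mem_eqSet_of_lyap_eq_zero hx ?_
  have hbal := c.energy_balance hn hx
  rw [Finset.sum_eq_zero fun i hi => by rw [ha i hi, c.viscous_eq_zero hv]; simp,
    Finset.sum_eq_zero fun i hi => by rw [hv i hi]; simp] at hbal
  by_contra hne
  have h1 := c.decayRate_pos hn (lt_of_le_of_ne (c.lyap_nonneg hx) (Ne.symm hne))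
  have h2 := c.decayRate_le_dissipation hn hx
  linarith

theorem not_isBounded_eqSet (hn : 2 ≤ n) : ¬ Bornology.IsBounded (c.eqSet n) := by
  intro hb
  obtain ⟨R, hR⟩ := hb.exists_norm_le
  have h2 : 2 ∈ Finset.Icc 2 n := Finset.mem_Icc.2 ⟨le_rfl, hn⟩
  set M : ℝ := max c.lam (|R| + 1)
  let y : State n := WithLp.toLp 2 (Sum.elim (fun _ => M) (fun _ => c.vstar))
  have hy : y ∈ c.eqSet n := by
    refine ⟨fun i hi => ?_, fun i hi => ?_⟩
    · rw [spacing_of_mem _ hi]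
      exact le_max_left _ _
    · rw [speed_of_mem _ hi]
      rfl
  have h1 := (PiLp.norm_apply_le y (Sum.inl ⟨2, h2⟩)).trans (hR y hy)
  have h3 : |R| + 1 ≤ ‖y (Sum.inl ⟨2, h2⟩)‖ := (le_max_right _ _).trans (le_abs_self M)
  linarith [le_abs_self R]

/-- Compare with the point of `E_S` obtained by raising short spacings to `λ`; only shortfalls below
`λ` count. -/
theorem infDist_eqSet_le {x : State n} {r : ℝ} (hr : 0 ≤ r)
    (h₁ : ∀ i ∈ Finset.Icc 2 n, c.lam - spacing x i ≤ r)
    (h₂ : ∀ i ∈ Finset.Icc 1 n, |speed x i - c.vstar| ≤ r) :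
    Metric.infDist x (c.eqSet n) ≤
      (Fintype.card (Finset.Icc 2 n ⊕ Finset.Icc 1 n) + 1) * r := by
  let y : State n := WithLp.toLp 2 (Sum.elim (fun i : Finset.Icc 2 n => max c.lam (spacing x i))
    (fun _ => c.vstar))
  have hys : ∀ i ∈ Finset.Icc 2 n, spacing y i = max c.lam (spacing x i) := fun i hi => by
    rw [spacing_of_mem _ hi]
    rfl
  have hyv : ∀ i ∈ Finset.Icc 1 n, speed y i = c.vstar := fun i hi => by
    rw [speed_of_mem _ hi]
    rfl
  have hy : y ∈ c.eqSet n := ⟨fun i hi => by rw [hys i hi]; exact le_max_left _ _, hyv⟩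
  refine (Metric.infDist_le_dist_of_mem hy).trans ?_
  rw [dist_eq_norm]
  refine norm_le_of_coord_le hr (fun i hi => ?_) fun i hi => ?_
  · rw [← spacingCLM_apply, map_sub, spacingCLM_apply, spacingCLM_apply, hys i hi, abs_sub_comm,
      abs_of_nonneg (sub_nonneg.2 (le_max_right _ _)), sub_le_iff_le_add]
    exact max_le (by linarith [h₁ i hi]) (by linarith)
  · rw [← speedCLM_apply, map_sub, speedCLM_apply, speedCLM_apply, hyv i hi]
    exact h₂ i hi

/-- States with small Lyapunov function are close to the set of equilibria. -/
theorem exists_forall_lyap_lt (n : ℕ) {ε : ℝ} (hε : 0 < ε) :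
    ∃ δ > 0, ∀ x ∈ c.stateSpace n, c.lyap x < δ → Metric.infDist x (c.eqSet n) < ε := by
  set N : ℝ := Fintype.card (Finset.Icc 2 n ⊕ Finset.Icc 1 n) + 1 with hN
  have hN0 : 0 < N := by positivity
  set e : ℝ := ε / (2 * N) with he
  have he0 : 0 < e := by positivity
  have hm := c.vmax_pos
  have hcont : ContinuousAt c.b 0 := c.continuous_b.continuousAt
  obtain ⟨η, hη, hbη⟩ := Metric.continuousAt_iff.1 hcont (e / 2) (by positivity)
  obtain ⟨δ, hδ, hδV⟩ := c.exists_forall_V_lt (ε := min e (η / 2)) (lt_min he0 (by positivity))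
  refine ⟨min δ (e ^ 2 / 8), lt_min hδ (by positivity), fun x hx hlt => ?_⟩
  obtain ⟨hlδ, hle⟩ := lt_min_iff.1 hlt
  -- Error budget for `|vᵢ - v*|`: `e/2` from `b`, whose argument is a difference of two values in
  -- `(-η/2, 0]`, and `e/2` from `|vᵢ - fᵢ|`, by `H ≤ e²/8` and `vᵢ (v_max - vᵢ) ≤ v_max²`.
  have hV : ∀ i ∈ Finset.Icc 2 n, c.lam - spacing x i < min e (η / 2) ∧
      -deriv c.V (spacing x i) < min e (η / 2) := fun i hi =>
    hδV _ (hx.1 i hi) ((c.V_le_lyap hx hi).trans_lt hlδ)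
  have hdV : ∀ j, -(η / 2) < c.dV x j ∧ c.dV x j ≤ 0 := fun j => by
    unfold dV
    split_ifs with hj
    · have := (hV j hj).2.trans_le (min_le_right _ _)
      exact ⟨by linarith, c.deriv_V_nonpos (hx.1 j hj)⟩
    · exact ⟨by linarith, le_rfl⟩
  refine (c.infDist_eqSet_le he0.le (fun i hi => ?_) fun i hi => ?_).trans_lt (b := N * e) ?_
  · exact (hV i hi).1.le.trans (min_le_left _ _)
  · have hgap : dist (c.dV x (i + 1) - c.dV x i) 0 < η := by
      rw [Real.dist_eq, sub_zero, abs_lt]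
      constructor <;> linarith [hdV (i + 1), hdV i, (hdV (i + 1)).1, (hdV i).1, (hdV (i + 1)).2,
        (hdV i).2]
    have hb := hbη hgap
    rw [c.b_zero, Real.dist_eq, sub_zero] at hb
    have hw : |speed x i - c.desired x i| ≤ e / 2 := by
      refine abs_le_of_sq_le_sq ?_ (by positivity)
      have h1 := c.sq_le_lyap hx hi
      obtain ⟨hv0, hv1⟩ := hx.2 i hi
      have h2 : speed x i * (c.vmax - speed x i) ≤ c.vmax ^ 2 := by nlinarith
      have h3 := mul_le_mul hle.le h2 (c.speed_mul_pos hx hi).le (by positivity)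
      have h4 : c.vmax ^ 2 * (speed x i - c.desired x i) ^ 2 ≤ c.vmax ^ 2 * (e / 2) ^ 2 := by
        linarith
      exact le_of_mul_le_mul_left h4 (by positivity)
    have h5 : speed x i - c.vstar =
        (speed x i - c.desired x i) - c.b (c.dV x (i + 1) - c.dV x i) := by
      unfold desired
      ring
    rw [h5]
    refine (abs_sub _ _).trans ?_
    linarith
  · rw [he]
    field_simp
    linarith

/-- Although `Ω_S` is unbounded, large spacings cost nothing; this is the boundedness needed by
`exists_isClassKInfty`. -/
theorem infDist_le_of_mem_stateSpace {x : State n} (hx : x ∈ c.stateSpace n) :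
    Metric.infDist x (c.eqSet n) ≤
      (Fintype.card (Finset.Icc 2 n ⊕ Finset.Icc 1 n) + 1) * max (c.lam - c.L) c.vmax := by
  have h1 := c.vstar_pos
  have h2 := c.vstar_lt_vmax
  refine c.infDist_eqSet_le (le_max_of_le_right c.vmax_pos.le) (fun i hi => ?_) fun i hi => ?_
  · exact le_max_of_le_left (by linarith [hx.1 i hi])
  · obtain ⟨h3, h4⟩ := hx.2 i hi
    refine le_max_of_le_right (abs_le.2 ⟨by linarith, by linarith⟩)

end Controller

end OpenRoad

end

/-! ### Equilibria, global existence and the `KL` estimate combined -/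

theorem theorem4 (n : ℕ) (hn : 2 ≤ n) (c : Controller) :
    -- `E_S` is the set of equilibria in `Ω_S`, and it is unbounded and not compact
    c.eqSet n = {x ∈ c.stateSpace n | c.field x = 0} ∧
    ¬ Bornology.IsBounded (c.eqSet n) ∧ ¬ IsCompact (c.eqSet n) ∧
    -- every state in `Ω_S` is the initial state of a solution defined for all `t ≥ 0`
    (∀ x₀ ∈ c.stateSpace n, ∃ x : ℝ → State n,
      IsSolution (c.stateSpace n) c.field ⊤ x ∧ x 0 = x₀) ∧
    ∃ (σ : ℝ → ℝ → ℝ) (a : ℝ → ℝ), IsClassKL σ ∧ IsClassKInfty a ∧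
      -- every solution is defined for all `t ≥ 0`
      (∀ (T : EReal) (x : ℝ → State n),
        IsMaximalSolution (c.stateSpace n) c.field T x → T = ⊤) ∧
      -- the estimate holds along every solution
      (∀ (T : EReal) (x : ℝ → State n), IsSolution (c.stateSpace n) c.field T x →
        ∀ t ∈ timeInterval T,
          a (Metric.infDist (x t) (c.eqSet n)) ≤ c.lyap (x t) ∧
          c.lyap (x t) ≤ σ (c.lyap (x 0)) t) := by
  have hn1 : 1 ≤ n := by omega
  refine ⟨c.eqSet_eq hn1, c.not_isBounded_eqSet hn,
    fun h => c.not_isBounded_eqSet hn h.isBounded, fun x₀ hx₀ => ?_, ?_⟩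
  · obtain ⟨T, x, hx, hx0⟩ :=
      exists_isSolution (c.isOpen_stateSpace n) (c.contDiffOn_field n) hx₀
    obtain ⟨S, y, hy, -, heq⟩ := hx.exists_isMaximalSolution
    obtain rfl := c.eq_top_of_isMaximalSolution hn1 hy
    exact ⟨y, hy.1, (heq ⟨le_rfl, by exact_mod_cast hx.1⟩).trans hx0⟩
  · obtain ⟨σ, hσ, hσle⟩ := exists_isClassKL (c.continuous_decayRate n).continuousOn
      (c.monotoneOn_decayRate n) (c.decayRate_zero n) fun _ hy => c.decayRate_pos hn1 hy
    obtain ⟨a, ha, hale⟩ := exists_isClassKInfty (c.stateSpace n)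
      (fun x => Metric.infDist x (c.eqSet n)) c.lyap _ (fun _ _ => Metric.infDist_nonneg)
      (fun _ hx => c.infDist_le_of_mem_stateSpace hx) (fun _ hx => c.lyap_nonneg hx)
      fun _ hε => c.exists_forall_lyap_lt n hε
    refine ⟨σ, a, hσ, ha, fun T x hx => c.eq_top_of_isMaximalSolution hn1 hx,
      fun T x hx t ht => ⟨hale _ (hx.2 t ht).1, ?_⟩⟩
    exact hσle _ _ _ ht.1 (c.lyap_nonneg (hx.2 t ht).1) (Controller.lyap_add_mul_le hn1 hx ht)
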